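/- Matrices have real or complex entries, $\|\cdot\|_p$ is the matrix norm induced by the vector $p$-norm, and $\kappa_p(M)=\|M\|_p\,\|M^{-1}\|_p$ for nonsingular $M$. **Simple stretchings.** Let $A=\begin{bmatrix}A_1\\A_2\end{bmatrix}$ be square, with a block $A_2$ of $d$ rows, and let the columns be partitioned into $k\ge 1$ (possibly empty) blocks, $A_i=[A_{i,1}\ \cdots\ A_{i,k}]$. A *simple row stretching* replaces $A$ by $$A^S=\begin{bmatrix}A_{1,1}&A_{1,2}&\cdots&A_{1,k}&0&\cdots&0\\ A_{2,1}&&&&-D_1&&\\ &A_{2,2}&&&+D_1&\ddots&\\ &&\ddots&&&\ddots&-D_{k-1}\\ &&&A_{2,k}&&&+D_{k-1}\end{bmatrix}$$ where $D_1,\dots,D_{k-1}$ (the glue) are nonsingular $d\times d$ matrices. Each row of $A_2$ stretches to $k$ rows of $A^S$, and each row of $A_1$ to one. Rows and columns may be reordered arbitrarily before and after. A *simple column stretching* is the transposed construction: it splits a block of columns according to a partition of the rows and appends glue rows. In a sequence $A\to A^S\to A^{SS}\to\cdots\to A^{SS\cdots S}$ the number of rows (columns) to which a row (column) of $A$ stretches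 is the number of its descendants in the final matrix. A sequence of row (column) stretchings is *disjoint* if no stretching in it stretches a row (column) that descends from a row (column) stretched earlier in the sequence. **Theorem 5.** Let $A$ be a nonsingular square matrix and let $A\to A^S\to\cdots\to A^{SS\cdots S}$ be a sequence of simple row stretchings, or a sequence of simple column stretchings (but not both), in which each row (respectively column) of $A$ stretches to at most $m$ rows (columns) of $A^{SS\cdots S}$ and all the glue matrices are $D_i=\sigma I$ with the same $\sigma$. Let $p\in\{1,\infty\}$ and choose $\sigma$ by the table $$\begin{array}{l|cc}\sigma&p=1&p=\infty\\\hline \text{row}&\|A\|_p/2&\|A\|_p\\ \text{column}&\|A\|_p&\|A\|_p/2\end{array}$$ Then $A^{SS\cdots S}$ is nonsingular and $\kappa_p(A^{SS\cdots S})\le c\,\kappa_p(A)$ with $$\begin{array}{l|cc}c&p=1&p=\infty\\\hline \text{row}&2m-1&m^2\\ \text{column}&m^2&2m-1\end{array}$$ If the sequence is disjoint, then $3m$ can replace $m^2$ in this table. All these bounds are sharp for some matrices: in each of the four cases, for every $m\ge 1$, some nonsingular $A$ of positive order and some sequence as above attain equality with $c=2m-1$, respectively $c=m^2$; and for every $m\ge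 3$, in the two cases with $m^2$, some nonsingular $A$ of positive order and some disjoint sequence attain equality with $c=3m$. -/

import Mathlib

open scoped ENNReal

noncomputable section

namespace Stretching

/-- The matrix norm `‖A‖_p` induced by the vector `p`-norm, that is, the operator norm of `A` as a
map from `ℓ^p` to `ℓ^p`. -/
def pNorm {𝕜 : Type*} [RCLike 𝕜] (p : ℝ≥0∞) [Fact (1 ≤ p)] {n : ℕ}
    (A : Matrix (Fin n) (Fin n) 𝕜) : ℝ :=
  ‖LinearMap.toContinuousLinearMap (Matrix.toLpLin p p A)‖

/-- The condition number `κ_p(A) = ‖A‖_p ‖A⁻¹‖_p` (meaningful for nonsingular `A`). -/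
def cond {𝕜 : Type*} [RCLike 𝕜] (p : ℝ≥0∞) [Fact (1 ≤ p)] {n : ℕ}
    (A : Matrix (Fin n) (Fin n) 𝕜) : ℝ :=
  pNorm p A * pNorm p A⁻¹

/-- The choices that determine one simple (row or column) stretching of a matrix of order `n` to a
matrix of order `N`. The word *line* means *row* for row stretching and *column* for column
stretching; a *cross line* is a column, respectively a row.
No order is imposed on the lines, and blocks need not consist of adjacent cross lines; together with
the arbitrary bijections `lines` and `cross` this accounts for all reorderings of the rows and
columns both before and after the stretching. -/
structure Simple (𝕜 : Type*) [RCLike 𝕜] (n N : ℕ) where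
  /-- the lines that are stretched (the block `A₂`) -/
  dense : Finset (Fin n)
  /-- the number of blocks minus one; every stretched line becomes `q + 1` lines -/
  q : ℕ
  /-- the partition of the cross lines into `q + 1` (possibly empty) blocks -/
  block : Fin n → Fin (q + 1)
  /-- the glue matrices `D₁, …, D_q` -/
  glue : Fin q → Matrix dense dense 𝕜
  /-- the glue matrices are nonsingular -/
  glue_nonsingular : ∀ s, IsUnit (glue s).det
  /-- the position of each line in the stretched matrix: an unstretched line `i`, or the `t`-th of
  the `q + 1` lines stretched from the line `i` -/
  lines : {i : Fin n // i ∉ dense} ⊕ Fin (q + 1) × dense ≃ Fin N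
  /-- the position of each cross line in the stretched matrix: an old one, or a new one, which
  holds glue -/
  cross : Fin n ⊕ Fin q × dense ≃ Fin N

namespace Simple

variable {𝕜 : Type*} [RCLike 𝕜] {n N : ℕ}

/-- The template of simple row stretching. With the columns of `A = [A₁; A₂]` partitioned into
`q + 1` blocks (numbered from `0` here) it is
`[A₁,₀ A₁,₁ … A₁,q | 0]` on top of the rows
`[0 … A₂,ₜ … 0 | 0 … +Dₜ₋₁ -Dₜ … 0]`, with `-Dₛ` in the `s`-th copy of the rows
of `A₂` and `+Dₛ` in the copy that follows. -/
def rowTemplate (S : Simple 𝕜 n N) (A : Matrix (Fin n) (Fin n) 𝕜) :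
    Matrix ({i : Fin n // i ∉ S.dense} ⊕ Fin (S.q + 1) × S.dense)
      (Fin n ⊕ Fin S.q × S.dense) 𝕜
  | .inl i, .inl j => A i j
  | .inl _, .inr _ => 0
  | .inr (t, i), .inl j => if S.block j = t then A i j else 0
  | .inr (t, i), .inr (s, k) =>
      if t = s.castSucc then -S.glue s i k else if t = s.succ then S.glue s i k else 0

/-- The template of simple column stretching. With the rows of `A = [A₁ A₂]` partitioned into
`q + 1` blocks, the `t`-th block of rows is `[Aₜ,₁ | 0 … Aₜ,₂ … 0]` and the glue rows are
`[0 | 0 … -Dₛ +Dₛ … 0]`, with `-Dₛ` in the `s`-th copy of the columns of `A₂` and `+Dₛ` in the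
copy that follows. -/
def colTemplate (S : Simple 𝕜 n N) (A : Matrix (Fin n) (Fin n) 𝕜) :
    Matrix (Fin n ⊕ Fin S.q × S.dense)
      ({i : Fin n // i ∉ S.dense} ⊕ Fin (S.q + 1) × S.dense) 𝕜
  | .inl i, .inl j => A i j
  | .inr _, .inl _ => 0
  | .inl i, .inr (t, j) => if S.block i = t then A i j else 0
  | .inr (s, k), .inr (t, j) =>
      if t = s.castSucc then -S.glue s k j else if t = s.succ then S.glue s k j else 0

/-- The simple row stretching of `A` determined by `S`. -/
def row (S : Simple 𝕜 n N) (A : Matrix (Fin n) (Fin n) 𝕜) : Matrix (Fin N) (Fin N) 𝕜 :=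
  Matrix.reindex S.lines S.cross (S.rowTemplate A)

/-- The simple column stretching of `A` determined by `S`. -/
def col (S : Simple 𝕜 n N) (A : Matrix (Fin n) (Fin n) 𝕜) : Matrix (Fin N) (Fin N) 𝕜 :=
  Matrix.reindex S.cross S.lines (S.colTemplate A)

/-- The line from which a line of the stretched matrix comes. -/
def parent (S : Simple 𝕜 n N) (r : Fin N) : Fin n :=
  match S.lines.symm r with
  | .inl i => i
  | .inr (_, i) => i

end Simple

/-- A finite sequence `A → A^S → A^SS → ⋯` of simple stretchings, from order `n` to order `N`. It
is used as a whole either for rows or for columns. -/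
inductive Chain (𝕜 : Type*) [RCLike 𝕜] (n : ℕ) : ℕ → Type _
  | nil : Chain 𝕜 n n
  | snoc {k N : ℕ} (T : Chain 𝕜 n k) (S : Simple 𝕜 k N) : Chain 𝕜 n N

namespace Chain

variable {𝕜 : Type*} [RCLike 𝕜] {n : ℕ}

/-- The final matrix when all the stretchings in the sequence are row stretchings. -/
def row (A : Matrix (Fin n) (Fin n) 𝕜) : {N : ℕ} → Chain 𝕜 n N → Matrix (Fin N) (Fin N) 𝕜
  | _, nil => A
  | _, snoc T S => S.row (T.row A)

/-- The final matrix when all the stretchings in the sequence are column stretchings. -/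
def col (A : Matrix (Fin n) (Fin n) 𝕜) : {N : ℕ} → Chain 𝕜 n N → Matrix (Fin N) (Fin N) 𝕜
  | _, nil => A
  | _, snoc T S => S.col (T.col A)

/-- All the glue matrices of all the stretchings in the sequence equal `σ I`. -/
def HasGlue (σ : 𝕜) : {N : ℕ} → Chain 𝕜 n N → Prop
  | _, nil => True
  | _, snoc T S => T.HasGlue σ ∧ ∀ s, S.glue s = σ • (1 : Matrix S.dense S.dense 𝕜)

/-- The line of the original matrix from which a line of the final matrix descends. -/
def origin : {N : ℕ} → Chain 𝕜 n N → Fin N → Fin n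
  | _, nil => fun r => r
  | _, snoc T S => fun r => T.origin (S.parent r)

/-- Each line of the original matrix stretches to at most `m` lines of the final matrix. -/
def AtMost (m : ℕ) {N : ℕ} (T : Chain 𝕜 n N) : Prop :=
  ∀ i : Fin n, (Finset.univ.filter fun r : Fin N => T.origin r = i).card ≤ m

/-- The lines of the final matrix that come from a line stretched somewhere in the sequence. -/
def stretched : {N : ℕ} → Chain 𝕜 n N → Set (Fin N)
  | _, nil => ∅
  | _, snoc T S => {r | S.parent r ∈ T.stretched ∨ S.parent r ∈ S.dense}

/-- Disjoint sequences: no stretching alters a line that an earlier stretching in the sequence has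
stretched. -/
def IsDisjoint : {N : ℕ} → Chain 𝕜 n N → Prop
  | _, nil => True
  | _, snoc T S => T.IsDisjoint ∧ ∀ i ∈ S.dense, i ∉ T.stretched

end Chain

end Stretching

end

/-!
Transposition exchanges row and column stretching and the norms `‖·‖₁` and `‖·‖_∞`, so only row
stretching has to be considered.

A sequence of row stretchings of `A` with glue `σ I` leads to a matrix `M` of a simple shape
(`GlueForest`): every entry `A i j` sits in one of the descendants of row `i`, and every glue column
has the entries `-σ` and `σ` in two descendants of the same row, so that it is an edge of a graph on
the rows of `M`. A stretching subdivides vertices of this graph into paths, hence the graph is a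
tree on the descendants of each row. If the sequence is disjoint, these trees are paths.

Let `M z = b`, where `z` consists of the unknowns `x` of the columns of `A` and `y` of the edges.
Adding the equations of all descendants of row `i` eliminates `y`
(`GlueForest.sum_fiber_mulVec`), so `x = A⁻¹ s` with `sᵢ` the sum of `b` over the descendants of row
`i`. Adding the equations on one side of an edge `g` gives `± σ y_g`. Doing so on both sides and
averaging, one obtains `2 |σ| |y_g| ≤ ∑ⱼ |Aᵢⱼ| |xⱼ| + ∑ |b_r|` with `r` running through the
descendants of row `i` (`GlueForest.two_mul_norm_edge_le`). The two sides of `g` are found without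
graph theory: they are the level sets of the row of `M⁻¹` that belongs to `g`.

* For `p = 1` the columns of `M` have the `1`-norms of those of `A` or `2σ = ‖A‖₁`, and a row with
  at most `m` descendants has at most `m - 1` edges. So `‖M‖₁ ≤ ‖A‖₁` and
  `‖z‖₁ ≤ (2m - 1) ‖A⁻¹‖₁ ‖b‖₁`.
* For `p = ∞` a row of `M` meets at most `m - 1` edges, and at most two if the trees are paths. So
  `‖M‖_∞` is at most `m ‖A‖_∞`, respectively `3 ‖A‖_∞`, while `‖M⁻¹‖_∞ ≤ m ‖A⁻¹‖_∞`.

All the bounds are attained by the matrix `A = [1]` of order one. For `2m - 1` it is stretched to a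
path whose end holds the entry `1`; for `m²` to a star whose centre holds it, built by repeatedly
splitting off a row; for `3m` to a path one of whose inner rows holds it.
-/

noncomputable section

namespace Stretching

/-! ### The induced `1`- and `∞`-norms -/

section Norms

variable {𝕜 : Type*} [RCLike 𝕜] {n : ℕ}

theorem pNorm_nonneg (p : ℝ≥0∞) [Fact (1 ≤ p)] (A : Matrix (Fin n) (Fin n) 𝕜) :
    0 ≤ pNorm p A :=
  norm_nonneg _

theorem norm_coe_pNorm (p : ℝ≥0∞) [Fact (1 ≤ p)] (A : Matrix (Fin n) (Fin n) 𝕜) :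
    ‖((pNorm p A : ℝ) : 𝕜)‖ = pNorm p A := by
  rw [RCLike.norm_ofReal, abs_of_nonneg (pNorm_nonneg p A)]

theorem norm_toLp_mulVec_le (p : ℝ≥0∞) [Fact (1 ≤ p)] (A : Matrix (Fin n) (Fin n) 𝕜)
    (x : Fin n → 𝕜) :
    ‖WithLp.toLp p (A.mulVec x)‖ ≤ pNorm p A * ‖WithLp.toLp p x‖ := by
  have := (LinearMap.toContinuousLinearMap (Matrix.toLpLin p p A)).le_opNorm (WithLp.toLp p x)
  simpa [pNorm, Matrix.toLpLin_apply] using this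

theorem pNorm_le_of_mulVec (p : ℝ≥0∞) [Fact (1 ≤ p)] (A : Matrix (Fin n) (Fin n) 𝕜) {C : ℝ}
    (hC : 0 ≤ C)
    (h : ∀ x : Fin n → 𝕜, ‖WithLp.toLp p (A.mulVec x)‖ ≤ C * ‖WithLp.toLp p x‖) :
    pNorm p A ≤ C := by
  refine ContinuousLinearMap.opNorm_le_bound _ hC fun x => ?_
  simpa [Matrix.toLpLin_apply] using h (WithLp.ofLp x)

theorem norm_toLp_one (x : Fin n → 𝕜) : ‖WithLp.toLp 1 x‖ = ∑ i, ‖x i‖ := by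
  simp [PiLp.norm_eq_of_L1]

theorem sum_norm_mulVec_le (A : Matrix (Fin n) (Fin n) 𝕜) (x : Fin n → 𝕜) :
    ∑ i, ‖A.mulVec x i‖ ≤ pNorm 1 A * ∑ j, ‖x j‖ := by
  simpa only [norm_toLp_one] using norm_toLp_mulVec_le 1 A x

theorem sum_norm_col_le_pNorm_one (A : Matrix (Fin n) (Fin n) 𝕜) (j : Fin n) :
    ∑ i, ‖A i j‖ ≤ pNorm 1 A := by
  have h := sum_norm_mulVec_le A (Pi.single j 1)
  have h1 : ∑ k, ‖(Pi.single j 1 : Fin n → 𝕜) k‖ = 1 := by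
    rw [Finset.sum_eq_single j] <;> simp +contextual
  simpa [h1] using h

theorem pNorm_one_le_of_sum_norm_mulVec {A : Matrix (Fin n) (Fin n) 𝕜} {C : ℝ} (hC : 0 ≤ C)
    (h : ∀ x : Fin n → 𝕜, ∑ i, ‖A.mulVec x i‖ ≤ C * ∑ j, ‖x j‖) : pNorm 1 A ≤ C :=
  pNorm_le_of_mulVec 1 A hC fun x => by simpa only [norm_toLp_one] using h x

theorem pNorm_one_le_of_sum_norm_col {A : Matrix (Fin n) (Fin n) 𝕜} {C : ℝ} (hC : 0 ≤ C)
    (h : ∀ j, ∑ i, ‖A i j‖ ≤ C) : pNorm 1 A ≤ C := by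
  refine pNorm_one_le_of_sum_norm_mulVec hC fun x => ?_
  calc ∑ i, ‖A.mulVec x i‖ ≤ ∑ i, ∑ j, ‖A i j‖ * ‖x j‖ := by
        gcongr with i
        simp only [← norm_mul]
        exact norm_sum_le Finset.univ fun j => A i j * x j
    _ = ∑ j, (∑ i, ‖A i j‖) * ‖x j‖ := by
        rw [Finset.sum_comm]; simp_rw [Finset.sum_mul]
    _ ≤ ∑ j, C * ‖x j‖ := by gcongr with j; exact h j
    _ = C * ∑ j, ‖x j‖ := by rw [Finset.mul_sum]

theorem norm_mulVec_apply_le (A : Matrix (Fin n) (Fin n) 𝕜) {x : Fin n → 𝕜} {B : ℝ}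
    (hB : 0 ≤ B) (hx : ∀ j, ‖x j‖ ≤ B) (i : Fin n) : ‖A.mulVec x i‖ ≤ pNorm ∞ A * B := by
  have h1 : ‖WithLp.toLp ∞ x‖ ≤ B := by
    rw [PiLp.norm_toLp]; exact (pi_norm_le_iff_of_nonneg hB).2 hx
  have h2 := norm_toLp_mulVec_le ∞ A x
  rw [PiLp.norm_toLp] at h2
  exact (norm_le_pi_norm _ i).trans
    (h2.trans (mul_le_mul_of_nonneg_left h1 (pNorm_nonneg _ _)))

theorem pNorm_top_le_of_norm_mulVec {A : Matrix (Fin n) (Fin n) 𝕜} {C : ℝ} (hC : 0 ≤ C)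
    (h : ∀ (x : Fin n → 𝕜) (B : ℝ), 0 ≤ B → (∀ j, ‖x j‖ ≤ B) → ∀ i, ‖A.mulVec x i‖ ≤ C * B) :
    pNorm ∞ A ≤ C := by
  refine pNorm_le_of_mulVec ∞ A hC fun x => ?_
  rw [PiLp.norm_toLp, PiLp.norm_toLp]
  exact (pi_norm_le_iff_of_nonneg (by positivity)).2
    (h x ‖x‖ (norm_nonneg _) (norm_le_pi_norm x))

theorem sum_norm_row_le_pNorm_top (A : Matrix (Fin n) (Fin n) 𝕜) (i : Fin n) :
    ∑ j, ‖A i j‖ ≤ pNorm ∞ A := by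
  -- The test vector carries the conjugate phases of the entries of row `i`.
  let x : Fin n → 𝕜 := fun j => (starRingEnd 𝕜) (A i j) / (‖A i j‖ : 𝕜)
  have hx : ∀ j, ‖x j‖ ≤ 1 := fun j => by
    simp only [x, norm_div, RCLike.norm_conj, RCLike.norm_ofReal, abs_norm]
    exact div_self_le_one _
  have hA : A.mulVec x i = ((∑ j, ‖A i j‖ : ℝ) : 𝕜) := by
    simp only [Matrix.mulVec, dotProduct, x, map_sum]
    refine Finset.sum_congr rfl fun j _ => ?_
    rw [← mul_div_assoc, RCLike.mul_conj]
    by_cases h : A i j = 0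
    · simp [h]
    · have : (‖A i j‖ : 𝕜) ≠ 0 := by simpa using h
      field_simp
  have h := norm_mulVec_apply_le A zero_le_one hx i
  rw [hA, RCLike.norm_ofReal, abs_of_nonneg (by positivity), mul_one] at h
  exact h

theorem pNorm_top_le_of_sum_norm_row {A : Matrix (Fin n) (Fin n) 𝕜} {C : ℝ} (hC : 0 ≤ C)
    (h : ∀ i, ∑ j, ‖A i j‖ ≤ C) : pNorm ∞ A ≤ C := by
  refine pNorm_top_le_of_norm_mulVec hC fun x B hB hx i => ?_
  calc ‖A.mulVec x i‖ ≤ ∑ j, ‖A i j‖ * ‖x j‖ := by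
        simp only [← norm_mul]
        exact norm_sum_le Finset.univ fun j => A i j * x j
    _ ≤ ∑ j, ‖A i j‖ * B := by gcongr with j; exact hx j
    _ = (∑ j, ‖A i j‖) * B := by rw [Finset.sum_mul]
    _ ≤ C * B := by gcongr; exact h i

theorem pNorm_top_transpose (A : Matrix (Fin n) (Fin n) 𝕜) : pNorm ∞ A.transpose = pNorm 1 A :=
  le_antisymm
    (pNorm_top_le_of_sum_norm_row (pNorm_nonneg _ _) fun i => sum_norm_col_le_pNorm_one A i)
    (pNorm_one_le_of_sum_norm_col (pNorm_nonneg _ _) fun j =>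
      sum_norm_row_le_pNorm_top A.transpose j)

theorem pNorm_one_transpose (A : Matrix (Fin n) (Fin n) 𝕜) : pNorm 1 A.transpose = pNorm ∞ A := by
  rw [← pNorm_top_transpose, Matrix.transpose_transpose]

theorem cond_top_transpose (A : Matrix (Fin n) (Fin n) 𝕜) : cond ∞ A.transpose = cond 1 A := by
  rw [cond, cond, ← Matrix.transpose_nonsing_inv, pNorm_top_transpose, pNorm_top_transpose]

theorem cond_one_transpose (A : Matrix (Fin n) (Fin n) 𝕜) : cond 1 A.transpose = cond ∞ A := by
  rw [← cond_top_transpose, Matrix.transpose_transpose]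

theorem pNorm_pos (p : ℝ≥0∞) [Fact (1 ≤ p)] {A : Matrix (Fin n) (Fin n) 𝕜} (hn : 0 < n)
    (hA : IsUnit A.det) : 0 < pNorm p A := by
  refine lt_of_le_of_ne (pNorm_nonneg p A) fun h => ?_
  have h0 : A = 0 := by
    have h1 := norm_eq_zero.1 h.symm
    simpa using h1
  have : Nonempty (Fin n) := ⟨⟨0, hn⟩⟩
  simp [h0] at hA

theorem one_le_cond (p : ℝ≥0∞) [Fact (1 ≤ p)] {A : Matrix (Fin n) (Fin n) 𝕜} (hn : 0 < n)
    (hA : IsUnit A.det) : 1 ≤ cond p A := by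
  let x : Fin n → 𝕜 := Pi.single ⟨0, hn⟩ 1
  have hx : 0 < ‖WithLp.toLp p x‖ := by
    rw [norm_pos_iff]
    intro h
    have h1 := congrArg (fun v : WithLp p (Fin n → 𝕜) => WithLp.ofLp v ⟨0, hn⟩) h
    simp [x] at h1
  have h1 := norm_toLp_mulVec_le p A (A⁻¹.mulVec x)
  have h2 := norm_toLp_mulVec_le p A⁻¹ x
  rw [Matrix.mulVec_mulVec, Matrix.mul_nonsing_inv _ hA, Matrix.one_mulVec] at h1
  have h3 : 1 * ‖WithLp.toLp p x‖ ≤ cond p A * ‖WithLp.toLp p x‖ := by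
    rw [cond, one_mul, mul_assoc]
    exact h1.trans (mul_le_mul_of_nonneg_left h2 (pNorm_nonneg _ _))
  exact le_of_mul_le_mul_right h3 hx

end Norms

/-! ### Transposition exchanges row and column stretching -/

section Flip

variable {𝕜 : Type*} [RCLike 𝕜] {n N : ℕ}

/-- The same stretching with every glue matrix transposed. It turns the column stretching of a
matrix into the row stretching of its transpose. -/
def Simple.flip (S : Simple 𝕜 n N) : Simple 𝕜 n N where
  dense := S.dense
  q := S.q
  block := S.block
  glue s := (S.glue s).transpose
  glue_nonsingular s := by rw [Matrix.det_transpose]; exact S.glue_nonsingular s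
  lines := S.lines
  cross := S.cross

theorem Simple.parent_eq_elim (S : Simple 𝕜 n N) (r : Fin N) :
    S.parent r = Sum.elim (fun i => i.1) (fun x => x.2.1) (S.lines.symm r) := by
  rw [Simple.parent]
  rcases S.lines.symm r with i | ⟨t, i⟩ <;> rfl

theorem Simple.parent_flip (S : Simple 𝕜 n N) (r : Fin N) : S.flip.parent r = S.parent r := by
  rw [parent_eq_elim, parent_eq_elim]
  rfl

theorem Simple.row_flip_transpose (S : Simple 𝕜 n N) (A : Matrix (Fin n) (Fin n) 𝕜) :
    S.flip.row A.transpose = (S.col A).transpose := by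
  have h : S.flip.rowTemplate A.transpose = (S.colTemplate A).transpose := by
    ext (i | ⟨t, i⟩) (j | ⟨s, j⟩) <;> rfl
  rw [Simple.row, h]
  rfl

/-- The same sequence of stretchings with every glue matrix transposed. -/
def Chain.flip : {N : ℕ} → Chain 𝕜 n N → Chain 𝕜 n N
  | _, .nil => .nil
  | _, .snoc T S => .snoc T.flip S.flip

namespace Chain

theorem row_flip_transpose (A : Matrix (Fin n) (Fin n) 𝕜) (T : Chain 𝕜 n N) :
    T.flip.row A.transpose = (T.col A).transpose := by
  induction T with
  | nil => rfl
  | snoc T S ih => rw [flip, row, ih, Simple.row_flip_transpose, col]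

theorem col_flip_transpose (A : Matrix (Fin n) (Fin n) 𝕜) (T : Chain 𝕜 n N) :
    T.flip.col A.transpose = (T.row A).transpose := by
  have flip_flip : T.flip.flip = T := by
    induction T with
    | nil => rfl
    | snoc T S ih => rw [flip, flip, ih]; rfl
  have h := row_flip_transpose A.transpose T.flip
  rw [flip_flip, Matrix.transpose_transpose] at h
  rw [h, Matrix.transpose_transpose]

theorem origin_flip (T : Chain 𝕜 n N) : T.flip.origin = T.origin := by
  induction T with
  | nil => rfl
  | snoc T S ih => funext r; simp only [flip, origin, ih, Simple.parent_flip]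

theorem stretched_flip (T : Chain 𝕜 n N) : T.flip.stretched = T.stretched := by
  induction T with
  | nil => rfl
  | snoc T S ih => simp only [flip, stretched, ih, Simple.parent_flip]; rfl

theorem AtMost.flip {m : ℕ} {T : Chain 𝕜 n N} (h : T.AtMost m) : T.flip.AtMost m := by
  simpa only [AtMost, origin_flip] using h

theorem HasGlue.flip {σ : 𝕜} {T : Chain 𝕜 n N} (h : T.HasGlue σ) : T.flip.HasGlue σ := by
  induction T with
  | nil => trivial
  | snoc T S ih =>
    refine ⟨ih h.1, fun s => ?_⟩
    change (S.glue s).transpose = _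
    rw [h.2 s, Matrix.transpose_smul, Matrix.transpose_one]
    rfl

theorem IsDisjoint.flip {T : Chain 𝕜 n N} (h : T.IsDisjoint) : T.flip.IsDisjoint := by
  induction T with
  | nil => trivial
  | snoc T S ih =>
    refine ⟨ih h.1, fun i hi => ?_⟩
    rw [stretched_flip]
    exact h.2 i hi

end Chain

end Flip

/-! ### One simple row stretching in terms of parents and children -/

namespace Simple

variable {𝕜 : Type*} [RCLike 𝕜] {n N : ℕ} (S : Simple 𝕜 n N)

/-- The `t`-th line of the stretched matrix that comes from the line `r`; an unstretched line has
only one child, whatever `t` is. -/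
def child (t : Fin (S.q + 1)) (r : Fin n) : Fin N :=
  if h : r ∈ S.dense then S.lines (.inr (t, ⟨r, h⟩)) else S.lines (.inl ⟨r, h⟩)

theorem child_of_mem (t : Fin (S.q + 1)) (k : S.dense) : S.child t k = S.lines (.inr (t, k)) := by
  simp [child]

theorem child_of_not_mem (t : Fin (S.q + 1)) (i : {i : Fin n // i ∉ S.dense}) :
    S.child t i = S.lines (.inl i) := by
  simp [child, i.2]

@[simp]
theorem parent_lines_inl (i : {i : Fin n // i ∉ S.dense}) : S.parent (S.lines (.inl i)) = i := by
  simp [parent_eq_elim]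

@[simp]
theorem parent_lines_inr (x : Fin (S.q + 1) × S.dense) : S.parent (S.lines (.inr x)) = x.2 := by
  simp [parent_eq_elim]

@[simp]
theorem parent_child (t : Fin (S.q + 1)) (r : Fin n) : S.parent (S.child t r) = r := by
  unfold child
  split_ifs with h <;> simp

theorem exists_eq_child_parent (r : Fin N) : ∃ t, r = S.child t (S.parent r) := by
  obtain ⟨i | ⟨t, k⟩, rfl⟩ := S.lines.surjective r
  · exact ⟨0, by rw [parent_lines_inl, child_of_not_mem]⟩
  · exact ⟨t, by rw [parent_lines_inr, child_of_mem]⟩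

theorem child_inj {t t' : Fin (S.q + 1)} {k k' : S.dense} :
    S.child t k = S.child t' k' ↔ t = t' ∧ k = k' := by
  simp [child_of_mem]

theorem row_cross_inl (A : Matrix (Fin n) (Fin n) 𝕜) (r : Fin N) (c : Fin n) :
    S.row A r (S.cross (.inl c)) =
      if r = S.child (S.block c) (S.parent r) then A (S.parent r) c else 0 := by
  obtain ⟨i | ⟨t, k⟩, rfl⟩ := S.lines.surjective r
  · simp [row, rowTemplate, child_of_not_mem]
  · simp [row, rowTemplate, child_of_mem, eq_comm]

theorem row_cross_inr (A : Matrix (Fin n) (Fin n) 𝕜) {σ : 𝕜} (hσ : ∀ s, S.glue s = σ • 1)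
    (r : Fin N) (s : Fin S.q) (k : S.dense) :
    S.row A r (S.cross (.inr (s, k))) =
      if r = S.child s.castSucc k then -σ else if r = S.child s.succ k then σ else 0 := by
  obtain ⟨i | ⟨t, l⟩, rfl⟩ := S.lines.surjective r
  · simp [row, rowTemplate, child_of_mem]
  · simp only [row, Matrix.reindex_apply, Matrix.submatrix_apply, Equiv.symm_apply_apply,
      rowTemplate, hσ, child_of_mem, S.lines.injective.eq_iff, Sum.inr.injEq, Prod.mk.injEq,
      Matrix.smul_apply, Matrix.one_apply, smul_eq_mul]
    by_cases h : l = k <;> simp [h]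

theorem sum_comp_parent (f : Fin n → ℕ) :
    ∑ r, f (S.parent r) = ∑ i, f i + S.q * ∑ k : S.dense, f k := by
  rw [← S.lines.sum_comp, Fintype.sum_sum_type, Fintype.sum_prod_type]
  simp only [parent_lines_inl, parent_lines_inr, Finset.sum_const, Finset.card_univ,
    Fintype.card_fin, smul_eq_mul]
  have h : ∑ i, f i = ∑ k : S.dense, f k + ∑ i : {i // i ∉ S.dense}, f i :=
    by convert (Fintype.sum_subtype_add_sum_subtype (· ∈ S.dense) f).symm
  rw [h]
  ring

end Simple

/-! ### Forests of glue -/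

/-- The shape of the matrices `M` that arise from `A` by a sequence of simple row stretchings with
glue `σ I`, where `π` sends each row of `M` to the row of `A` it descends from. The glue columns of
`M` are the edges of a graph on the rows of `M`, and this graph restricts to a tree on the
descendants of each row of `A`. The tree property is encoded by connectedness together with the
number of edges. -/
structure GlueForest {𝕜 : Type*} [RCLike 𝕜] {n N : ℕ} (A : Matrix (Fin n) (Fin n) 𝕜) (σ : 𝕜)
    (M : Matrix (Fin N) (Fin N) 𝕜) (π : Fin N → Fin n) where
  /-- the glue columns, viewed as edges between rows -/
  Edge : Type
  /-- there are finitely many edges -/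
  [fintype : Fintype Edge]
  /-- the columns of `M` are those of `A` and the glue columns -/
  col : Fin n ⊕ Edge ≃ Fin N
  /-- `pos i j` is the descendant of row `i` that holds the entry `A i j` -/
  pos : Fin n → Fin n → Fin N
  /-- the row in which a glue column has the entry `-σ` -/
  tail : Edge → Fin N
  /-- the row in which a glue column has the entry `σ` -/
  head : Edge → Fin N
  origin_pos : ∀ i j, π (pos i j) = i
  origin_tail : ∀ g, π (tail g) = π (head g)
  tail_ne_head : ∀ g, tail g ≠ head g
  apply_inl : ∀ r j, M r (col (.inl j)) = if r = pos (π r) j then A (π r) j else 0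
  apply_inr : ∀ r g, M r (col (.inr g)) = if r = tail g then -σ else if r = head g then σ else 0
  card_edge : ∀ i, (Finset.univ.filter fun g => π (tail g) = i).card + 1 =
    (Finset.univ.filter fun r => π r = i).card
  connected : ∀ w : Fin N → 𝕜, (∀ g, w (tail g) = w (head g)) →
    ∀ r r', π r = π r' → w r = w r'

attribute [instance] GlueForest.fintype

namespace GlueForest

variable {𝕜 : Type*} [RCLike 𝕜] {n N : ℕ} {A : Matrix (Fin n) (Fin n) 𝕜} {σ : 𝕜}

/-- No stretching at all gives a forest without edges. -/
def refl (A : Matrix (Fin n) (Fin n) 𝕜) (σ : 𝕜) : GlueForest A σ A (fun r => r) where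
  Edge := Empty
  col := Equiv.sumEmpty _ _
  pos i _ := i
  tail := Empty.elim
  head := Empty.elim
  origin_pos _ _ := rfl
  origin_tail g := g.elim
  tail_ne_head g := g.elim
  apply_inl r j := by simp
  apply_inr r g := g.elim
  card_edge i := by simp [Finset.filter_eq']
  connected w _ r r' h := by rw [h]

/-- A further stretching subdivides the vertices that are stretched into paths of new edges, and
the old edges are attached to these paths as the partition of the columns prescribes. -/
def stretch {k : ℕ} {M : Matrix (Fin k) (Fin k) 𝕜} {π : Fin k → Fin n} (F : GlueForest A σ M π)
    (S : Simple 𝕜 k N) (hS : ∀ s, S.glue s = σ • 1) :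
    GlueForest A σ (S.row M) (fun r => π (S.parent r)) where
  Edge := F.Edge ⊕ Fin S.q × S.dense
  col := (Equiv.sumAssoc _ _ _).symm.trans ((Equiv.sumCongr F.col (Equiv.refl _)).trans S.cross)
  pos i j := S.child (S.block (F.col (.inl j))) (F.pos i j)
  tail
    | .inl g => S.child (S.block (F.col (.inr g))) (F.tail g)
    | .inr (s, l) => S.child s.castSucc l
  head
    | .inl g => S.child (S.block (F.col (.inr g))) (F.head g)
    | .inr (s, l) => S.child s.succ l
  origin_pos i j := by simp [F.origin_pos]
  origin_tail := by rintro (g | ⟨s, l⟩) <;> simp [F.origin_tail]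
  tail_ne_head := by
    rintro (g | ⟨s, l⟩) h
    · exact F.tail_ne_head g (by simpa using congrArg S.parent h)
    · exact s.castSucc_lt_succ.ne (S.child_inj.1 h).1
  apply_inl r j := by
    change S.row M r (S.cross (.inl (F.col (.inl j)))) = _
    rw [S.row_cross_inl, F.apply_inl]
    have h : r = S.child (S.block (F.col (.inl j))) (F.pos (π (S.parent r)) j) ↔
        r = S.child (S.block (F.col (.inl j))) (S.parent r) ∧
          S.parent r = F.pos (π (S.parent r)) j := by
      constructor
      · intro h
        have h' := congrArg S.parent h
        rw [S.parent_child] at h'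
        exact ⟨by rw [h', ← h], h'⟩
      · rintro ⟨h1, h2⟩
        rw [← h2, ← h1]
    simp only [h, ite_and]
  apply_inr := by
    rintro r (g | ⟨s, l⟩)
    · change S.row M r (S.cross (.inl (F.col (.inr g)))) = _
      rw [S.row_cross_inl, F.apply_inr]
      have h (v : Fin k) : r = S.child (S.block (F.col (.inr g))) v ↔
          r = S.child (S.block (F.col (.inr g))) (S.parent r) ∧ S.parent r = v := by
        constructor
        · intro h
          have h' := congrArg S.parent h
          rw [S.parent_child] at h'
          exact ⟨by rw [h', ← h], h'⟩
        · rintro ⟨h1, h2⟩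
          rw [← h2, ← h1]
      simp only [h (F.tail g), h (F.head g)]
      by_cases h1 : r = S.child (S.block (F.col (.inr g))) (S.parent r)
      · simp only [← h1, if_true, true_and]
      · simp only [h1, if_false, false_and]
    · exact S.row_cross_inr M hS r s l
  card_edge i := by
    have h1 := F.card_edge i
    have h2 := S.sum_comp_parent fun r => if π r = i then 1 else 0
    have h3 : ∑ x : Fin S.q × S.dense, (if π x.2 = i then 1 else 0) =
        S.q * ∑ l : S.dense, if π l = i then 1 else 0 := by
      rw [Fintype.sum_prod_type' fun (_ : Fin S.q) (l : S.dense) => if π l = i then 1 else 0,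
        Finset.sum_const, Finset.card_univ, Fintype.card_fin, smul_eq_mul]
    rw [Finset.card_filter, Finset.card_filter] at h1 ⊢
    rw [h2, ← h3, ← h1, Fintype.sum_sum_type]
    simp only [S.parent_child]
    omega
  connected w hw := by
    have hold (l : S.dense) (t : Fin (S.q + 1)) : w (S.child t l) = w (S.child 0 l) := by
      induction t using Fin.induction with
      | zero => rfl
      | succ s ih => rw [← ih]; exact (hw (.inr (s, l))).symm
    -- Since the new paths are connected, `w` factors through `S.parent`.
    have hchild (t t' : Fin (S.q + 1)) (r : Fin k) : w (S.child t r) = w (S.child t' r) := by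
      by_cases h : r ∈ S.dense
      · exact (hold ⟨r, h⟩ t).trans (hold ⟨r, h⟩ t').symm
      · simp [Simple.child, h]
    intro r r' hr
    obtain ⟨t, ht⟩ := S.exists_eq_child_parent r
    obtain ⟨t', ht'⟩ := S.exists_eq_child_parent r'
    rw [ht, ht', hchild t 0, hchild t' 0]
    refine F.connected (fun v => w (S.child 0 v)) (fun g => ?_) _ _ hr
    have := hw (.inl g)
    simp only at this ⊢
    rw [hchild 0 (S.block (F.col (.inr g))), this, hchild]

end GlueForest

theorem Chain.nonempty_glueForest {𝕜 : Type*} [RCLike 𝕜] {n N : ℕ}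
    (A : Matrix (Fin n) (Fin n) 𝕜) {σ : 𝕜} (T : Chain 𝕜 n N) (hT : T.HasGlue σ) :
    Nonempty (GlueForest A σ (T.row A) T.origin) := by
  induction T with
  | nil => exact ⟨.refl A σ⟩
  | snoc T S ih =>
    obtain ⟨F⟩ := ih hT.1
    exact ⟨F.stretch S hT.2⟩

/-- In a disjoint sequence every tree is a path: each line is the tail of at most one edge and the
head of at most one edge. -/
theorem Chain.IsDisjoint.exists_glueForest {𝕜 : Type*} [RCLike 𝕜] {n N : ℕ}
    (A : Matrix (Fin n) (Fin n) 𝕜) {σ : 𝕜} {T : Chain 𝕜 n N} (hT : T.HasGlue σ)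
    (hd : T.IsDisjoint) :
    ∃ F : GlueForest A σ (T.row A) T.origin,
      Function.Injective F.tail ∧ Function.Injective F.head := by
  -- The induction carries along that edges only join lines that have been stretched.
  suffices ∃ F : GlueForest A σ (T.row A) T.origin,
      Function.Injective F.tail ∧ Function.Injective F.head ∧
        ∀ g, F.tail g ∈ T.stretched ∧ F.head g ∈ T.stretched by
    obtain ⟨F, h1, h2, -⟩ := this
    exact ⟨F, h1, h2⟩
  induction T with
  | nil => exact ⟨.refl A σ, fun g => g.elim, fun g => g.elim, fun g => g.elim⟩
  | snoc T S ih =>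
    obtain ⟨F, htail, hhead, hmem⟩ := ih hT.1 hd.1
    have key {t t' : Fin (S.q + 1)} {v : Fin _} (hv : v ∈ T.stretched) (l : S.dense)
        (h : S.child t v = S.child t' l) : False := by
      have h' := congrArg S.parent h
      simp only [S.parent_child] at h'
      exact hd.2 l l.2 (h' ▸ hv)
    refine ⟨F.stretch S hT.2, ?_, ?_, ?_⟩
    · rintro (g | ⟨s, l⟩) (g' | ⟨s', l'⟩) h
      · have h' := congrArg S.parent h
        simp only [GlueForest.stretch, S.parent_child] at h'
        exact congrArg _ (htail h')
      · exact (key (hmem g).1 l' h).elim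
      · exact (key (hmem g').1 l h.symm).elim
      · obtain ⟨h1, h2⟩ := S.child_inj.1 h
        rw [Fin.castSucc_injective _ h1, h2]
    · rintro (g | ⟨s, l⟩) (g' | ⟨s', l'⟩) h
      · have h' := congrArg S.parent h
        simp only [GlueForest.stretch, S.parent_child] at h'
        exact congrArg _ (hhead h')
      · exact (key (hmem g).2 l' h).elim
      · exact (key (hmem g').2 l h.symm).elim
      · obtain ⟨h1, h2⟩ := S.child_inj.1 h
        rw [Fin.succ_injective _ h1, h2]
    · rintro (g | ⟨s, l⟩)
      · constructor <;> left
        · exact (S.parent_child _ _).symm ▸ (hmem g).1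
        · exact (S.parent_child _ _).symm ▸ (hmem g).2
      · constructor <;> right
        · exact (S.parent_child _ _).symm ▸ l.2
        · exact (S.parent_child _ _).symm ▸ l.2
/-! ### The equations behind the inverse of a stretched matrix -/

namespace GlueForest

section Equations

variable {𝕜 : Type*} [RCLike 𝕜] {n N : ℕ} {A : Matrix (Fin n) (Fin n) 𝕜} {σ : 𝕜}
  {M : Matrix (Fin N) (Fin N) 𝕜} {π : Fin N → Fin n}

theorem sum_col_eq (F : GlueForest A σ M π) {β : Type*} [AddCommMonoid β] (f : Fin N → β) :
    ∑ c, f c = ∑ j, f (F.col (.inl j)) + ∑ g, f (F.col (.inr g)) := by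
  rw [← F.col.sum_comp, Fintype.sum_sum_type]

theorem sum_apply_inl (F : GlueForest A σ M π)
    {β : Type*} [AddCommMonoid β] (φ : Fin N → 𝕜 → β) (hφ : ∀ r, φ r 0 = 0)
    (j : Fin n) : ∑ r, φ r (M r (F.col (.inl j))) = ∑ i, φ (F.pos i j) (A i j) := by
  rw [← Finset.sum_fiberwise Finset.univ π]
  refine Finset.sum_congr rfl fun i _ => ?_
  rw [Finset.sum_eq_single (F.pos i j)]
  · rw [F.apply_inl, F.origin_pos, if_pos rfl]
  · intro r hr hne
    rw [(Finset.mem_filter.1 hr).2.symm] at hne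
    rw [F.apply_inl, if_neg hne, hφ]
  · intro h
    simp [F.origin_pos] at h

theorem sum_apply_inr (F : GlueForest A σ M π)
    {β : Type*} [AddCommMonoid β] (φ : Fin N → 𝕜 → β) (hφ : ∀ r, φ r 0 = 0)
    (g : F.Edge) :
    ∑ r, φ r (M r (F.col (.inr g))) = φ (F.tail g) (-σ) + φ (F.head g) σ := by
  rw [Fintype.sum_eq_add _ _ (F.tail_ne_head g)]
  · rw [F.apply_inr, F.apply_inr, if_pos rfl, if_neg (F.tail_ne_head g).symm, if_pos rfl]
  · rintro r ⟨h1, h2⟩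
    rw [F.apply_inr, if_neg h1, if_neg h2, hφ]

/-- A vector of the left kernel takes equal values at the ends of every edge, so it comes from a
vector of the left kernel of `A`. -/
theorem isUnit_det (F : GlueForest A σ M π)
    (hA : IsUnit A.det) (hσ : 0 < n → σ ≠ 0) : IsUnit M.det := by
  rw [isUnit_iff_ne_zero]
  intro h0
  obtain ⟨w, hw0, hw⟩ := Matrix.exists_vecMul_eq_zero_iff.2 h0
  have hcol (c : Fin N) : ∑ r, w r * M r c = 0 := congrFun hw c
  apply hw0
  have hedge (g : F.Edge) : w (F.tail g) = w (F.head g) := by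
    have h := hcol (F.col (.inr g))
    rw [F.sum_apply_inr (fun r a => w r * a) (by simp)] at h
    have h' : σ * (w (F.head g) - w (F.tail g)) = 0 := by linear_combination h
    rcases mul_eq_zero.1 h' with h' | h'
    · exact (hσ (Fin.pos (π (F.tail g))) h').elim
    · exact (sub_eq_zero.1 h').symm
  have hconst := F.connected w hedge
  have hker (j₀ : Fin n) : (fun i => w (F.pos i j₀)) = 0 := by
    apply Matrix.vecMul_injective_of_isUnit ((Matrix.isUnit_iff_isUnit_det A).2 hA)
    funext j
    have h := hcol (F.col (.inl j))
    rw [F.sum_apply_inl (fun r a => w r * a) (by simp)] at h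
    simp only [Matrix.vecMul, dotProduct, Pi.zero_apply, zero_mul, Finset.sum_const_zero]
    rw [← h]
    refine Finset.sum_congr rfl fun i _ => ?_
    rw [hconst (F.pos i j₀) (F.pos i j) (by rw [F.origin_pos, F.origin_pos])]
  funext r
  rw [hconst r (F.pos (π r) (π r)) (by rw [F.origin_pos])]
  exact congrFun (hker (π r)) (π r)

/-- The sum of a set `W` of equations of the system `M z = b`. -/
theorem sum_mulVec (F : GlueForest A σ M π) (W : Finset (Fin N)) (z : Fin N → 𝕜) :
    ∑ r ∈ W, M.mulVec z r =
      ∑ j, (∑ i, if F.pos i j ∈ W then A i j else 0) * z (F.col (.inl j)) +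
      ∑ g, ((if F.tail g ∈ W then -σ else 0) + if F.head g ∈ W then σ else 0) *
        z (F.col (.inr g)) := by
  simp only [Matrix.mulVec, dotProduct]
  rw [Finset.sum_comm, F.sum_col_eq]
  congr 1
  · refine Finset.sum_congr rfl fun j _ => ?_
    rw [← F.sum_apply_inl (fun r a => if r ∈ W then a else 0) (by simp), ← Finset.sum_mul,
      Finset.sum_ite_mem, Finset.univ_inter]
  · refine Finset.sum_congr rfl fun g _ => ?_
    rw [← F.sum_apply_inr (fun r a => if r ∈ W then a else 0) (by simp), ← Finset.sum_mul,
      Finset.sum_ite_mem, Finset.univ_inter]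

/-- Summing the equations over all descendants of a row of `A` eliminates the glue. -/
theorem sum_fiber_mulVec (F : GlueForest A σ M π) (i : Fin n) (z : Fin N → 𝕜) :
    ∑ r with π r = i, M.mulVec z r = A.mulVec (fun j => z (F.col (.inl j))) i := by
  rw [F.sum_mulVec]
  simp only [Finset.mem_filter, Finset.mem_univ, true_and, F.origin_pos, Finset.sum_ite_eq',
    if_true, F.origin_tail]
  rw [Finset.sum_eq_zero (s := (Finset.univ : Finset F.Edge)), add_zero]
  · rfl
  · intro g _
    split_ifs <;> simp

/-- If `W` is a set of descendants of row `i` that only the edge `g` leaves, then the sum of the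
equations over `W` expresses the unknown of `g` in terms of the right-hand side and of the unknowns
of the original columns. -/
theorem norm_edge_le_of_cut (F : GlueForest A σ M π) {i : Fin n} {g : F.Edge} {W : Finset (Fin N)}
    (hW : ∀ r ∈ W, π r = i) (hg : F.tail g ∈ W ↔ F.head g ∉ W)
    (hne : ∀ g', g' ≠ g → (F.tail g' ∈ W ↔ F.head g' ∈ W)) (z : Fin N → 𝕜) :
    ‖σ‖ * ‖z (F.col (.inr g))‖ ≤
      ∑ j with F.pos i j ∈ W, ‖A i j‖ * ‖z (F.col (.inl j))‖ + ∑ r ∈ W, ‖M.mulVec z r‖ := by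
  have h := F.sum_mulVec W z
  have h1 (j : Fin n) : (∑ i', if F.pos i' j ∈ W then A i' j else 0) =
      if F.pos i j ∈ W then A i j else 0 := by
    refine Finset.sum_eq_single i (fun i' _ hi' => if_neg fun hmem => hi' ?_) (by simp)
    rw [← hW _ hmem, F.origin_pos]
  have h2 : ∑ g', ((if F.tail g' ∈ W then -σ else 0) + if F.head g' ∈ W then σ else 0) *
        z (F.col (.inr g')) =
      ((if F.tail g ∈ W then -σ else 0) + if F.head g ∈ W then σ else 0) *
        z (F.col (.inr g)) := by
    refine Finset.sum_eq_single g (fun g' _ hg' => ?_) (by simp)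
    by_cases hm : F.head g' ∈ W <;> simp [hne g' hg', hm]
  have h3 : ‖(if F.tail g ∈ W then -σ else 0) + if F.head g ∈ W then σ else 0‖ = ‖σ‖ := by
    by_cases hm : F.head g ∈ W <;> simp [hg, hm]
  rw [h2] at h
  simp only [h1] at h
  rw [← h3, ← norm_mul, ← sub_eq_iff_eq_add'.2 h, Finset.sum_filter, add_comm]
  refine (norm_sub_le _ _).trans (add_le_add (norm_sum_le _ _) ?_)
  refine (norm_sum_le _ _).trans (Finset.sum_le_sum fun j _ => ?_)
  split_ifs <;> simp

/-- Removing the edge `g` splits a tree into two parts, and each of the two sets of equations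
bounds the unknown of `g`. -/
theorem two_mul_norm_edge_le (F : GlueForest A σ M π)
    (hM : IsUnit M.det) (g : F.Edge) (z : Fin N → 𝕜) :
    2 * ‖σ‖ * ‖z (F.col (.inr g))‖ ≤
      ∑ j, ‖A (π (F.tail g)) j‖ * ‖z (F.col (.inl j))‖ +
        ∑ r with π r = π (F.tail g), ‖M.mulVec z r‖ := by
  classical
  set i := π (F.tail g) with hi
  -- The row of `M⁻¹` that belongs to `g` is constant on each of the two parts.
  set w : Fin N → 𝕜 := fun r => M⁻¹ (F.col (.inr g)) r with hw
  have hprod (g' : F.Edge) : σ * (w (F.head g') - w (F.tail g')) = if g' = g then 1 else 0 := by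
    have h : (M⁻¹ * M) (F.col (.inr g)) (F.col (.inr g')) =
        (1 : Matrix (Fin N) (Fin N) 𝕜) (F.col (.inr g)) (F.col (.inr g')) := by
      rw [Matrix.nonsing_inv_mul _ hM]
    rw [Matrix.mul_apply, F.sum_apply_inr (fun r a => M⁻¹ (F.col (.inr g)) r * a) (by simp),
      Matrix.one_apply] at h
    simp only [F.col.injective.eq_iff, Sum.inr.injEq, eq_comm (a := g)] at h
    rw [← h]
    ring
  have hg := hprod g
  rw [if_pos rfl] at hg
  have hσ : σ ≠ 0 := left_ne_zero_of_mul (hg ▸ one_ne_zero)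
  have hne : w (F.head g) ≠ w (F.tail g) := fun h => by simp [h] at hg
  have heq (g' : F.Edge) (h : g' ≠ g) : w (F.tail g') = w (F.head g') := by
    have h' := hprod g'
    rw [if_neg h] at h'
    exact (sub_eq_zero.1 ((mul_eq_zero.1 h').resolve_left hσ)).symm
  have hi' : π (F.head g) = i := (F.origin_tail g).symm
  have h1 := F.norm_edge_le_of_cut (i := i) (g := g)
    (W := {r ∈ Finset.univ.filter (fun r => π r = i) | w r = w (F.tail g)})
    (by simp +contextual) (by simp [← hi, hne])
    (fun g' h => by simp [heq g' h, F.origin_tail]) z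
  have h2 := F.norm_edge_le_of_cut (i := i) (g := g)
    (W := {r ∈ Finset.univ.filter (fun r => π r = i) | ¬ w r = w (F.tail g)})
    (by simp +contextual) (by simp [hi', hne])
    (fun g' h => by simp [heq g' h, F.origin_tail]) z
  rw [← Finset.sum_filter_add_sum_filter_not (Finset.univ.filter (fun r => π r = i))
      (fun r => w r = w (F.tail g)) fun r => ‖M.mulVec z r‖,
    ← Finset.sum_filter_add_sum_filter_not Finset.univ
      (fun j => w (F.pos i j) = w (F.tail g)) fun j => ‖A i j‖ * ‖z (F.col (.inl j))‖]
  simp only [Finset.mem_filter, Finset.mem_univ, true_and, F.origin_pos] at h1 h2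
  linarith

theorem card_pos (F : GlueForest A σ M π)
    (i : Fin n) : 0 < (Finset.univ.filter fun r => π r = i).card := by
  rw [← F.card_edge i]
  omega

theorem sum_norm_row_le (F : GlueForest A σ M π) (r : Fin N) :
    ∑ c, ‖M r c‖ ≤ pNorm ∞ A + ‖σ‖ * ((Finset.univ.filter fun g => F.tail g = r).card +
      (Finset.univ.filter fun g => F.head g = r).card) := by
  rw [F.sum_col_eq]
  refine add_le_add ?_ ?_
  · refine le_trans (Finset.sum_le_sum fun j _ => ?_) (sum_norm_row_le_pNorm_top A (π r))
    rw [F.apply_inl]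
    split_ifs <;> simp
  · rw [Finset.card_filter, Finset.card_filter]
    push_cast
    rw [← Finset.sum_add_distrib, Finset.mul_sum]
    refine Finset.sum_le_sum fun g _ => ?_
    rw [F.apply_inr]
    by_cases h1 : r = F.tail g
    · have h2 : F.head g ≠ r := fun h2 => F.tail_ne_head g (h1 ▸ h2.symm)
      simp [← h1, h2]
    · by_cases h2 : r = F.head g
      · simp [Ne.symm h1, ← h2, h1]
      · simp [h1, h2]
        positivity

end Equations

/-! ### Upper bounds for the condition numbers -/

section Bounds

variable {𝕜 : Type*} [RCLike 𝕜] {n N : ℕ} {A : Matrix (Fin n) (Fin n) 𝕜} {σ : 𝕜}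
  {M : Matrix (Fin N) (Fin N) 𝕜} {π : Fin N → Fin n}

/-- Every column of `M` has the entries of a column of `A` or consists of `-σ` and `σ`. -/
theorem pNorm_one_le (F : GlueForest A σ M π)
    (hσ : 2 * ‖σ‖ ≤ pNorm 1 A) : pNorm 1 M ≤ pNorm 1 A := by
  refine pNorm_one_le_of_sum_norm_col (pNorm_nonneg _ _) fun c => ?_
  obtain ⟨j | g, rfl⟩ := F.col.surjective c
  · rw [F.sum_apply_inl (fun _ a => ‖a‖) (by simp)]
    exact sum_norm_col_le_pNorm_one A j
  · rw [F.sum_apply_inr (fun _ a => ‖a‖) (by simp), norm_neg, ← two_mul]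
    exact hσ

theorem pNorm_one_inv_le (F : GlueForest A σ M π) {m : ℕ} (hn : 0 < n) (hA : IsUnit A.det)
    (hm : ∀ i, (Finset.univ.filter fun r => π r = i).card ≤ m) (hσ : 2 * ‖σ‖ = pNorm 1 A) :
    pNorm 1 M⁻¹ ≤ (2 * (m : ℝ) - 1) * pNorm 1 A⁻¹ := by
  have ha := pNorm_pos 1 hn hA
  have hκ := one_le_cond 1 hn hA
  have hσ0 : σ ≠ 0 := fun h => by rw [h, norm_zero] at hσ; linarith
  have hM := F.isUnit_det hA fun _ => hσ0
  have hm1 : (1 : ℝ) ≤ m := by exact_mod_cast (F.card_pos ⟨0, hn⟩).trans_le (hm _)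
  rw [cond] at hκ
  have hi0 := pNorm_nonneg 1 A⁻¹
  refine pNorm_one_le_of_sum_norm_mulVec (mul_nonneg (by linarith) hi0) fun b => ?_
  set z := M⁻¹.mulVec b with hz
  have hMz : M.mulVec z = b := by
    rw [hz, Matrix.mulVec_mulVec, Matrix.mul_nonsing_inv _ hM, Matrix.one_mulVec]
  set x : Fin n → 𝕜 := fun j => z (F.col (.inl j)) with hx
  have hAx (i : Fin n) : A.mulVec x i = ∑ r with π r = i, b r := by
    rw [← hMz, F.sum_fiber_mulVec]
  have hxA : x = A⁻¹.mulVec (A.mulVec x) := by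
    rw [Matrix.mulVec_mulVec, Matrix.nonsing_inv_mul _ hA, Matrix.one_mulVec]
  set B := ∑ r, ‖b r‖ with hB
  have hB0 : 0 ≤ B := by positivity
  have hX : ∑ j, ‖x j‖ ≤ pNorm 1 A⁻¹ * B := by
    conv_lhs => rw [hxA]
    refine (sum_norm_mulVec_le _ _).trans (mul_le_mul_of_nonneg_left ?_ hi0)
    rw [hB, ← Finset.sum_fiberwise Finset.univ π]
    exact Finset.sum_le_sum fun i _ => by rw [hAx]; exact norm_sum_le _ _
  have hY : pNorm 1 A * ∑ g, ‖z (F.col (.inr g))‖ ≤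
      (m - 1) * (pNorm 1 A * ∑ j, ‖x j‖ + B) := by
    set u : Fin n → ℝ := fun i => ∑ j, ‖A i j‖ * ‖x j‖ + ∑ r with π r = i, ‖b r‖ with hu
    have hu0 (i : Fin n) : 0 ≤ u i := by positivity
    calc pNorm 1 A * ∑ g, ‖z (F.col (.inr g))‖ ≤ ∑ g, u (π (F.tail g)) := by
          rw [Finset.mul_sum]
          refine Finset.sum_le_sum fun g _ => ?_
          have h := F.two_mul_norm_edge_le hM g z
          rwa [hσ, hMz] at h
      _ = ∑ i, ((Finset.univ.filter fun g => π (F.tail g) = i).card : ℝ) * u i := by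
          rw [← Finset.sum_fiberwise Finset.univ fun g => π (F.tail g)]
          refine Finset.sum_congr rfl fun i _ => ?_
          rw [← nsmul_eq_mul]
          refine Finset.sum_eq_card_nsmul fun g hg => ?_
          rw [(Finset.mem_filter.1 hg).2]
      _ ≤ ∑ i, ((m : ℝ) - 1) * u i := by
          refine Finset.sum_le_sum fun i _ => mul_le_mul_of_nonneg_right ?_ (hu0 i)
          rw [le_sub_iff_add_le]
          exact_mod_cast (F.card_edge i).trans_le (hm i)
      _ = (m - 1) * (∑ j, (∑ i, ‖A i j‖) * ‖x j‖ + B) := by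
          rw [← Finset.mul_sum, hu, Finset.sum_add_distrib, Finset.sum_fiberwise,
            Finset.sum_comm]
          simp_rw [Finset.sum_mul, hB]
      _ ≤ (m - 1) * (pNorm 1 A * ∑ j, ‖x j‖ + B) := by
          refine mul_le_mul_of_nonneg_left (add_le_add_left ?_ _) (by linarith)
          rw [Finset.mul_sum]
          exact Finset.sum_le_sum fun j _ =>
            mul_le_mul_of_nonneg_right (sum_norm_col_le_pNorm_one A j) (norm_nonneg _)
  have hY' : ∑ g, ‖z (F.col (.inr g))‖ ≤ (m - 1) * (2 * (pNorm 1 A⁻¹ * B)) := by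
    refine le_of_mul_le_mul_left (hY.trans ?_) ha
    have h1 : pNorm 1 A * ∑ j, ‖x j‖ ≤ pNorm 1 A * (pNorm 1 A⁻¹ * B) :=
      mul_le_mul_of_nonneg_left hX ha.le
    have h2 : B ≤ pNorm 1 A * (pNorm 1 A⁻¹ * B) := by
      rw [← mul_assoc]
      exact le_mul_of_one_le_left hB0 hκ
    calc ((m : ℝ) - 1) * (pNorm 1 A * ∑ j, ‖x j‖ + B)
        ≤ (m - 1) * (2 * (pNorm 1 A * (pNorm 1 A⁻¹ * B))) :=
          mul_le_mul_of_nonneg_left (by linarith) (by linarith)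
      _ = pNorm 1 A * ((m - 1) * (2 * (pNorm 1 A⁻¹ * B))) := by ring
  rw [F.sum_col_eq]
  calc ∑ j, ‖x j‖ + ∑ g, ‖z (F.col (.inr g))‖
      ≤ pNorm 1 A⁻¹ * B + (m - 1) * (2 * (pNorm 1 A⁻¹ * B)) := add_le_add hX hY'
    _ = (2 * (m : ℝ) - 1) * pNorm 1 A⁻¹ * B := by ring

theorem pNorm_top_inv_le (F : GlueForest A σ M π) {m : ℕ} (hn : 0 < n) (hA : IsUnit A.det)
    (hm : ∀ i, (Finset.univ.filter fun r => π r = i).card ≤ m) (hσ : ‖σ‖ = pNorm ∞ A) :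
    pNorm ∞ M⁻¹ ≤ m * pNorm ∞ A⁻¹ := by
  have ha := pNorm_pos ∞ hn hA
  have hκ := one_le_cond ∞ hn hA
  have hσ0 : σ ≠ 0 := fun h => by rw [h, norm_zero] at hσ; linarith
  have hM := F.isUnit_det hA fun _ => hσ0
  rw [cond] at hκ
  have hi0 := pNorm_nonneg ∞ A⁻¹
  refine pNorm_top_le_of_norm_mulVec (by positivity) fun b B hB0 hb c => ?_
  set z := M⁻¹.mulVec b with hz
  have hMz : M.mulVec z = b := by
    rw [hz, Matrix.mulVec_mulVec, Matrix.mul_nonsing_inv _ hM, Matrix.one_mulVec]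
  set x : Fin n → 𝕜 := fun j => z (F.col (.inl j)) with hx
  have hsum (i : Fin n) : ∑ r with π r = i, ‖b r‖ ≤ m * B :=
    (Finset.sum_le_card_nsmul _ _ B fun r _ => hb r).trans (by
      rw [nsmul_eq_mul]
      exact mul_le_mul_of_nonneg_right (by exact_mod_cast hm i) hB0)
  have hAx (i : Fin n) : ‖A.mulVec x i‖ ≤ m * B := by
    rw [← F.sum_fiber_mulVec, hMz]
    exact (norm_sum_le _ _).trans (hsum i)
  have hxA : x = A⁻¹.mulVec (A.mulVec x) := by
    rw [Matrix.mulVec_mulVec, Matrix.nonsing_inv_mul _ hA, Matrix.one_mulVec]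
  have hX (j : Fin n) : ‖x j‖ ≤ pNorm ∞ A⁻¹ * (m * B) := by
    rw [hxA]
    exact norm_mulVec_apply_le _ (by positivity) hAx j
  obtain ⟨j | g, rfl⟩ := F.col.surjective c
  · exact (hX j).trans_eq (by ring)
  · have h := F.two_mul_norm_edge_le hM g z
    rw [hMz, hσ] at h
    set i := π (F.tail g)
    have h1 : ∑ j, ‖A i j‖ * ‖z (F.col (.inl j))‖ ≤
        pNorm ∞ A * (pNorm ∞ A⁻¹ * (m * B)) := by
      refine (Finset.sum_le_sum fun j _ => mul_le_mul_of_nonneg_left (hX j)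
        (norm_nonneg _)).trans ?_
      rw [← Finset.sum_mul]
      exact mul_le_mul_of_nonneg_right (sum_norm_row_le_pNorm_top A i) (by positivity)
    have h2 : m * B ≤ pNorm ∞ A * (pNorm ∞ A⁻¹ * (m * B)) := by
      rw [← mul_assoc]
      exact le_mul_of_one_le_left (by positivity) hκ
    refine le_of_mul_le_mul_left ?_ (by positivity : 0 < 2 * pNorm ∞ A)
    calc 2 * pNorm ∞ A * ‖z (F.col (.inr g))‖
        ≤ 2 * (pNorm ∞ A * (pNorm ∞ A⁻¹ * (m * B))) := by linarith [hsum i]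
      _ = 2 * pNorm ∞ A * (m * pNorm ∞ A⁻¹ * B) := by ring

/-- A row of `M` meets at most `m - 1` edges. -/
theorem pNorm_top_le (F : GlueForest A σ M π)
    {m : ℕ} (hm : ∀ i, (Finset.univ.filter fun r => π r = i).card ≤ m)
    (hσ : ‖σ‖ = pNorm ∞ A) : pNorm ∞ M ≤ m * pNorm ∞ A := by
  classical
  have ha := pNorm_nonneg ∞ A
  refine pNorm_top_le_of_sum_norm_row (by positivity) fun r => (F.sum_norm_row_le r).trans ?_
  have hdeg : (Finset.univ.filter fun g => F.tail g = r).card +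
      (Finset.univ.filter fun g => F.head g = r).card + 1 ≤ m := by
    refine le_trans ?_ ((F.card_edge (π r)).trans_le (hm (π r)))
    rw [← Finset.card_union_of_disjoint]
    · refine Nat.add_le_add_right (Finset.card_le_card fun g hg => ?_) 1
      simp only [Finset.mem_union, Finset.mem_filter, Finset.mem_univ, true_and] at hg ⊢
      rcases hg with rfl | rfl
      · rfl
      · exact F.origin_tail g
    · refine Finset.disjoint_filter.2 fun g _ h1 h2 => F.tail_ne_head g (h1.trans h2.symm)
  rw [hσ]
  calc pNorm ∞ A + pNorm ∞ A * ((Finset.univ.filter fun g => F.tail g = r).card +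
        (Finset.univ.filter fun g => F.head g = r).card)
      = ((Finset.univ.filter fun g => F.tail g = r).card +
        (Finset.univ.filter fun g => F.head g = r).card + 1) * pNorm ∞ A := by ring
    _ ≤ m * pNorm ∞ A := mul_le_mul_of_nonneg_right (by exact_mod_cast hdeg) ha

/-- If the trees are paths, then a row of `M` meets at most two edges. -/
theorem pNorm_top_le_of_injective (F : GlueForest A σ M π) (htail : Function.Injective F.tail)
    (hhead : Function.Injective F.head) (hσ : ‖σ‖ = pNorm ∞ A) :
    pNorm ∞ M ≤ 3 * pNorm ∞ A := by
  have ha := pNorm_nonneg ∞ A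
  refine pNorm_top_le_of_sum_norm_row (by positivity) fun r => (F.sum_norm_row_le r).trans ?_
  have hcard {f : F.Edge → Fin N} (hf : Function.Injective f) :
      ((Finset.univ.filter fun g => f g = r).card : ℝ) ≤ 1 := by
    refine mod_cast Finset.card_le_one.2 fun g hg g' hg' => hf ?_
    rw [(Finset.mem_filter.1 hg).2, (Finset.mem_filter.1 hg').2]
  rw [hσ]
  calc _ ≤ pNorm ∞ A + pNorm ∞ A * (1 + 1) := by gcongr <;> apply hcard <;> assumption
    _ = 3 * pNorm ∞ A := by ring

end Bounds

end GlueForest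

theorem cond_eq_zero_of_eq_zero {𝕜 : Type*} [RCLike 𝕜] (p : ℝ≥0∞) [Fact (1 ≤ p)] {n : ℕ}
    (A : Matrix (Fin n) (Fin n) 𝕜) (hn : n = 0) : cond p A = 0 := by
  subst hn
  have : A = 0 := Subsingleton.elim _ _
  simp [cond, pNorm, this]

namespace Chain

variable {𝕜 : Type*} [RCLike 𝕜] {n N m : ℕ} {A : Matrix (Fin n) (Fin n) 𝕜} {T : Chain 𝕜 n N}

theorem eq_zero_of_eq_zero (T : Chain 𝕜 n N) (hn : n = 0) : N = 0 := by
  rcases Nat.eq_zero_or_pos N with h | h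
  · exact h
  · exact absurd (T.origin ⟨0, h⟩).pos (by omega)

theorem isUnit_det_row (hA : IsUnit A.det) {σ : 𝕜} (hT : T.HasGlue σ) (hσ : 0 < n → σ ≠ 0) :
    IsUnit (T.row A).det := by
  obtain ⟨F⟩ := T.nonempty_glueForest A hT
  exact F.isUnit_det hA hσ

theorem isUnit_det_row_one (hA : IsUnit A.det)
    (hT : T.HasGlue ((pNorm 1 A / 2 : ℝ) : 𝕜)) : IsUnit (T.row A).det :=
  isUnit_det_row hA hT fun hn => RCLike.ofReal_ne_zero.2 (half_pos (pNorm_pos 1 hn hA)).ne'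

theorem isUnit_det_row_top (hA : IsUnit A.det)
    (hT : T.HasGlue ((pNorm ∞ A : ℝ) : 𝕜)) : IsUnit (T.row A).det :=
  isUnit_det_row hA hT fun hn => RCLike.ofReal_ne_zero.2 (pNorm_pos ∞ hn hA).ne'

theorem cond_one_row_le (hA : IsUnit A.det) (hm : T.AtMost m)
    (hT : T.HasGlue ((pNorm 1 A / 2 : ℝ) : 𝕜)) :
    cond 1 (T.row A) ≤ (2 * (m : ℝ) - 1) * cond 1 A := by
  rcases Nat.eq_zero_or_pos n with hn | hn
  · rw [cond_eq_zero_of_eq_zero 1 A hn, cond_eq_zero_of_eq_zero 1 _ (T.eq_zero_of_eq_zero hn),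
      mul_zero]
  obtain ⟨F⟩ := T.nonempty_glueForest A hT
  have hσ : 2 * ‖((pNorm 1 A / 2 : ℝ) : 𝕜)‖ = pNorm 1 A := by
    rw [RCLike.norm_ofReal, abs_of_pos (half_pos (pNorm_pos 1 hn hA))]
    ring
  calc cond 1 (T.row A) ≤ pNorm 1 A * ((2 * (m : ℝ) - 1) * pNorm 1 A⁻¹) :=
        mul_le_mul (F.pNorm_one_le hσ.le) (F.pNorm_one_inv_le hn hA hm hσ) (pNorm_nonneg _ _)
          (pNorm_nonneg _ _)
    _ = (2 * (m : ℝ) - 1) * cond 1 A := by rw [cond]; ring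

theorem cond_top_row_le (hA : IsUnit A.det) (hm : T.AtMost m)
    (hT : T.HasGlue ((pNorm ∞ A : ℝ) : 𝕜)) :
    cond ∞ (T.row A) ≤ (m : ℝ) ^ 2 * cond ∞ A := by
  rcases Nat.eq_zero_or_pos n with hn | hn
  · rw [cond_eq_zero_of_eq_zero ∞ A hn, cond_eq_zero_of_eq_zero ∞ _ (T.eq_zero_of_eq_zero hn),
      mul_zero]
  obtain ⟨F⟩ := T.nonempty_glueForest A hT
  have hσ := norm_coe_pNorm ∞ A
  calc cond ∞ (T.row A) ≤ (m * pNorm ∞ A) * (m * pNorm ∞ A⁻¹) :=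
        mul_le_mul (F.pNorm_top_le hm hσ) (F.pNorm_top_inv_le hn hA hm hσ) (pNorm_nonneg _ _)
          (mul_nonneg (Nat.cast_nonneg _) (pNorm_nonneg _ _))
    _ = (m : ℝ) ^ 2 * cond ∞ A := by rw [cond]; ring

theorem IsDisjoint.cond_top_row_le (hd : T.IsDisjoint) (hA : IsUnit A.det) (hm : T.AtMost m)
    (hT : T.HasGlue ((pNorm ∞ A : ℝ) : 𝕜)) :
    cond ∞ (T.row A) ≤ 3 * (m : ℝ) * cond ∞ A := by
  rcases Nat.eq_zero_or_pos n with hn | hn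
  · rw [cond_eq_zero_of_eq_zero ∞ A hn, cond_eq_zero_of_eq_zero ∞ _ (T.eq_zero_of_eq_zero hn),
      mul_zero]
  obtain ⟨F, htail, hhead⟩ := hd.exists_glueForest A hT
  have hσ := norm_coe_pNorm ∞ A
  calc cond ∞ (T.row A) ≤ (3 * pNorm ∞ A) * (m * pNorm ∞ A⁻¹) :=
        mul_le_mul (F.pNorm_top_le_of_injective htail hhead hσ)
          (F.pNorm_top_inv_le hn hA hm hσ) (pNorm_nonneg _ _)
          (mul_nonneg zero_le_three (pNorm_nonneg _ _))
    _ = 3 * (m : ℝ) * cond ∞ A := by rw [cond]; ring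

end Chain

/-! ### Matrices that attain the bounds -/

section Sharpness

variable {𝕜 : Type*} [RCLike 𝕜]

theorem pNorm_one_one : pNorm 1 (1 : Matrix (Fin 1) (Fin 1) 𝕜) = 1 :=
  le_antisymm (pNorm_one_le_of_sum_norm_col zero_le_one fun j => by
    rw [Subsingleton.elim j 0]; simp)
    (by simpa using sum_norm_col_le_pNorm_one (1 : Matrix (Fin 1) (Fin 1) 𝕜) 0)

theorem pNorm_top_one : pNorm ∞ (1 : Matrix (Fin 1) (Fin 1) 𝕜) = 1 := by
  rw [← pNorm_one_transpose, Matrix.transpose_one, pNorm_one_one]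

theorem cond_one_one : cond 1 (1 : Matrix (Fin 1) (Fin 1) 𝕜) = 1 := by
  rw [cond, inv_one, pNorm_one_one, mul_one]

theorem cond_top_one : cond ∞ (1 : Matrix (Fin 1) (Fin 1) 𝕜) = 1 := by
  rw [cond, inv_one, pNorm_top_one, mul_one]

/-- The solution of `M z = (1, …, 1)` has the entry `N` in the column of the matrix `[1]`. -/
theorem GlueForest.le_pNorm_top_inv {N : ℕ} {σ : 𝕜} {M : Matrix (Fin N) (Fin N) 𝕜}
    {π : Fin N → Fin 1} (F : GlueForest (1 : Matrix (Fin 1) (Fin 1) 𝕜) σ M π)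
    (hM : IsUnit M.det) : (N : ℝ) ≤ pNorm ∞ M⁻¹ := by
  have h := F.sum_fiber_mulVec 0 (M⁻¹.mulVec fun _ => 1)
  rw [Matrix.mulVec_mulVec, Matrix.mul_nonsing_inv _ hM, Matrix.one_mulVec, Matrix.one_mulVec,
    Finset.filter_true_of_mem fun r _ => Subsingleton.elim (π r) 0] at h
  have h2 := norm_mulVec_apply_le M⁻¹ (x := fun _ => 1) zero_le_one (by simp) (F.col (.inl 0))
  rw [← h] at h2
  simpa using h2

theorem Chain.atMost_of_le {n N m : ℕ} (T : Chain 𝕜 n N) (h : N ≤ m) : T.AtMost m := fun _ =>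
  ((Finset.card_filter_le _ _).trans_eq (Finset.card_fin N)).trans h

/-- The simple stretching with glue `σ I` for given lines to be stretched and a given partition of
the cross lines. The order of the lines of the stretched matrix is left unspecified. -/
def Simple.ofScalar {n N : ℕ} (dense : Finset (Fin n)) (q : ℕ) (block : Fin n → Fin (q + 1))
    {σ : 𝕜} (hσ : σ ≠ 0) (hN : n + q * dense.card = N) : Simple 𝕜 n N where
  dense := dense
  q := q
  block := block
  glue _ := σ • 1
  glue_nonsingular _ := by simp [hσ]
  lines := Fintype.equivFinOfCardEq (by
    have h : Fintype.card {i : Fin n // i ∉ dense} + dense.card = n := by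
      rw [Fintype.card_subtype_compl, Fintype.card_coe, Fintype.card_fin]
      exact Nat.sub_add_cancel (card_finset_fin_le dense)
    rw [Fintype.card_sum, Fintype.card_prod, Fintype.card_fin, Fintype.card_coe]
    linarith)
  cross := Fintype.equivFinOfCardEq (by simp [hN])

/-- The stretching of the matrix `[1]` to a path of `q + 1` rows with the entry `1` in row `t`. -/
def Simple.path (q : ℕ) (t : Fin (q + 1)) {σ : 𝕜} (hσ : σ ≠ 0) : Simple 𝕜 1 (q + 1) :=
  .ofScalar Finset.univ q (fun _ => t) hσ (by simp [add_comm])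

/-- If a single row is stretched to a path and its entry stays at one end, then the unit vector at
the other end is the image of a vector with the entries `1` and, for each edge, `2`. -/
theorem Simple.le_pNorm_one_inv {N : ℕ} (S : Simple 𝕜 1 N) {σ : 𝕜} (h2 : σ * 2 = 1)
    (hd : 0 ∈ S.dense) (hb : S.block 0 = 0) (hS : ∀ s, S.glue s = σ • 1)
    (hM : IsUnit (S.row 1).det) : 2 * (S.q : ℝ) + 1 ≤ pNorm 1 (S.row 1)⁻¹ := by
  let z : Fin N → 𝕜 := fun c => Sum.elim (fun _ => 1) (fun _ => 2) (S.cross.symm c)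
  let o : S.dense := ⟨0, hd⟩
  have huniv : (Finset.univ : Finset S.dense) = {o} := by
    ext l
    simp [show l = o from Subtype.ext (Subsingleton.elim _ _)]
  have hz : (S.row 1).mulVec z = Pi.single (S.child (Fin.last S.q) o) 1 := by
    funext r
    obtain ⟨t, ht⟩ := S.exists_eq_child_parent r
    rw [show S.parent r = o from Subsingleton.elim _ _] at ht
    -- The contributions of the edges telescope.
    let f : Fin (S.q + 1) → 𝕜 := fun u => if t = u then 1 else 0
    have hterm (s : Fin S.q) :
        S.row 1 r (S.cross (.inr (s, o))) * 2 = f s.succ - f s.castSucc := by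
      rw [S.row_cross_inr 1 hS r s o, ht]
      simp only [S.child_inj, and_true, f]
      by_cases h1 : t = s.castSucc
      · have h3 : t ≠ s.succ := h1 ▸ s.castSucc_lt_succ.ne
        rw [if_pos h1, if_neg h3, if_pos h1]
        linear_combination -h2
      · by_cases h3 : t = s.succ
        · rw [if_neg h1, if_pos h3, if_pos h3, if_neg h1]
          linear_combination h2
        · simp [h1, h3]
    have hold : S.row 1 r (S.cross (.inl 0)) = f 0 := by
      rw [S.row_cross_inl, hb, ht, S.parent_child]
      simp only [S.child_inj, and_true, f]
      rw [show (o : Fin 1) = 0 from rfl, Matrix.one_apply_eq]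
    have htel : ∑ s : Fin S.q, (f s.succ - f s.castSucc) = f (Fin.last S.q) - f 0 := by
      rw [Finset.sum_sub_distrib]
      have h3 := Fin.sum_univ_succ f
      rw [Fin.sum_univ_castSucc] at h3
      linear_combination -h3
    calc (S.row 1).mulVec z r
        = S.row 1 r (S.cross (.inl 0)) +
            ∑ s : Fin S.q, S.row 1 r (S.cross (.inr (s, o))) * 2 := by
          rw [Matrix.mulVec, dotProduct, ← S.cross.sum_comp, Fintype.sum_sum_type,
            Fintype.sum_prod_type]
          simp [z, huniv]
      _ = f (Fin.last S.q) := by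
          simp only [hterm]
          rw [hold, htel]
          ring
      _ = _ := by simp only [f, Pi.single_apply, ht, S.child_inj, and_true]
  have hz' : z = (S.row 1)⁻¹.mulVec (Pi.single (S.child (Fin.last S.q) o) 1) := by
    rw [← hz, Matrix.mulVec_mulVec, Matrix.nonsing_inv_mul _ hM, Matrix.one_mulVec]
  have h := sum_norm_mulVec_le (S.row 1)⁻¹ (Pi.single (S.child (Fin.last S.q) o) 1)
  rw [← hz'] at h
  have h3 : ∑ c, ‖z c‖ = 2 * (S.q : ℝ) + 1 := by
    rw [← S.cross.sum_comp, Fintype.sum_sum_type, Fintype.sum_prod_type]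
    simp [z, huniv]
    ring
  have h4 : ∑ c, ‖(Pi.single (S.child (Fin.last S.q) o) 1 : Fin N → 𝕜) c‖ = 1 := by
    rw [Finset.sum_eq_single (S.child (Fin.last S.q) o)] <;> simp +contextual
  rw [h3, h4, mul_one] at h
  exact h

theorem exists_cond_one_row_eq {m : ℕ} (hm : 1 ≤ m) :
    ∃ (n N : ℕ) (A : Matrix (Fin n) (Fin n) 𝕜) (T : Chain 𝕜 n N),
      0 < n ∧ IsUnit A.det ∧ T.AtMost m ∧ T.HasGlue ((pNorm 1 A / 2 : ℝ) : 𝕜) ∧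
      cond 1 (T.row A) = (2 * (m : ℝ) - 1) * cond 1 A := by
  obtain ⟨q, rfl⟩ : ∃ q, m = q + 1 := ⟨m - 1, by omega⟩
  have hσ : ((pNorm 1 (1 : Matrix (Fin 1) (Fin 1) 𝕜) / 2 : ℝ) : 𝕜) ≠ 0 := by
    rw [pNorm_one_one]
    simp
  let T : Chain 𝕜 1 (q + 1) := .snoc .nil (.path q 0 hσ)
  have hA : IsUnit (1 : Matrix (Fin 1) (Fin 1) 𝕜).det := by simp
  have hT : T.HasGlue ((pNorm 1 (1 : Matrix (Fin 1) (Fin 1) 𝕜) / 2 : ℝ) : 𝕜) :=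
    ⟨trivial, fun _ => rfl⟩
  have hm := T.atMost_of_le le_rfl
  have hM := T.isUnit_det_row_one hA hT
  refine ⟨1, q + 1, 1, T, zero_lt_one, hA, hm, hT, (T.cond_one_row_le hA hm hT).antisymm ?_⟩
  have h1 : 2 * (q : ℝ) + 1 ≤ pNorm 1 (T.row 1)⁻¹ :=
    (Simple.path q 0 hσ).le_pNorm_one_inv (by rw [pNorm_one_one]; push_cast; norm_num)
      (Finset.mem_univ _) rfl (fun _ => rfl) hM
  have h2 : 1 ≤ pNorm 1 (T.row 1) := by
    -- The column of the matrix `[1]` keeps its entries.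
    obtain ⟨F⟩ := T.nonempty_glueForest 1 hT
    have h := sum_norm_col_le_pNorm_one (T.row 1) (F.col (.inl 0))
    rw [F.sum_apply_inl (fun _ a => ‖a‖) (by simp)] at h
    simpa using h
  rw [cond_one_one, cond]
  push_cast
  nlinarith

theorem cond_top_row_ge {N : ℕ} {T : Chain 𝕜 1 N}
    (hT : T.HasGlue ((pNorm ∞ (1 : Matrix (Fin 1) (Fin 1) 𝕜) : ℝ) : 𝕜)) {C : ℝ} {r : Fin N}
    (hr : C ≤ ∑ c, ‖T.row 1 r c‖) : C * N ≤ cond ∞ (T.row 1) := by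
  obtain ⟨F⟩ := T.nonempty_glueForest 1 hT
  have hM := T.isUnit_det_row_top (by simp) hT
  exact mul_le_mul (hr.trans (sum_norm_row_le_pNorm_top _ r)) (F.le_pNorm_top_inv hM)
    (Nat.cast_nonneg _) (pNorm_nonneg _ _)

/-- If the entries of row `r` stay together, then the row that gets them also gets glue. -/
theorem Simple.sum_norm_row_child {n N : ℕ} (S : Simple 𝕜 n N) {σ : 𝕜}
    (hS : ∀ s, S.glue s = σ • 1) {t : Fin (S.q + 1)} (ht : ∀ c, S.block c = t)
    (M : Matrix (Fin n) (Fin n) 𝕜) (l : S.dense) :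
    ∑ c, ‖S.row M (S.child t l) c‖ = ∑ c, ‖M l c‖ + ∑ x : Fin S.q × S.dense,
      ‖if t = x.1.castSucc ∧ l = x.2 then -σ else if t = x.1.succ ∧ l = x.2 then σ else 0‖ := by
  rw [← S.cross.sum_comp, Fintype.sum_sum_type]
  congr 1
  · simp [S.row_cross_inl, ht]
  · refine Finset.sum_congr rfl fun x _ => ?_
    rw [S.row_cross_inr M hS]
    simp only [S.child_inj]

theorem Simple.le_sum_norm_row_child_castSucc {n N : ℕ} (S : Simple 𝕜 n N) {σ : 𝕜}
    (hS : ∀ s, S.glue s = σ • 1) {s : Fin S.q} (hs : ∀ c, S.block c = s.castSucc)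
    (M : Matrix (Fin n) (Fin n) 𝕜) (l : S.dense) :
    ∑ c, ‖M l c‖ + ‖σ‖ ≤ ∑ c, ‖S.row M (S.child s.castSucc l) c‖ := by
  rw [S.sum_norm_row_child hS hs]
  refine add_le_add_right (le_trans ?_ (Finset.single_le_sum (fun _ _ => norm_nonneg _)
    (Finset.mem_univ (s, l)))) _
  simp

theorem Simple.le_sum_norm_row_child_inner {n N : ℕ} (S : Simple 𝕜 n N) {σ : 𝕜}
    (hS : ∀ s, S.glue s = σ • 1) {s s' : Fin S.q} (hss : s.succ = s'.castSucc)
    (hs : ∀ c, S.block c = s.succ) (M : Matrix (Fin n) (Fin n) 𝕜) (l : S.dense) :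
    ∑ c, ‖M l c‖ + 2 * ‖σ‖ ≤ ∑ c, ‖S.row M (S.child s.succ l) c‖ := by
  classical
  rw [S.sum_norm_row_child hS hs]
  have hne : s ≠ s' := by
    rintro rfl
    exact s.castSucc_lt_succ.ne' hss
  refine add_le_add_right (le_trans ?_ (Finset.sum_le_univ_sum_of_nonneg
    (s := {(s, l), (s', l)}) fun _ => norm_nonneg _)) _
  rw [Finset.sum_pair (by simp [hne])]
  simp [hss, hne.symm, two_mul]

/-- Splitting off one row of glue after another gives a star, whose centre keeps the entry `1` and
meets all glue columns. -/
theorem Chain.exists_star (N : ℕ) :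
    ∃ T : Chain 𝕜 1 (N + 1), T.HasGlue 1 ∧ ∃ r, (N : ℝ) + 1 ≤ ∑ c, ‖T.row 1 r c‖ := by
  induction N with
  | zero => exact ⟨.nil, trivial, 0, by simp [Chain.row]⟩
  | succ N ih =>
    obtain ⟨T, hT, r, hr⟩ := ih
    let S : Simple 𝕜 (N + 1) (N + 1 + 1) :=
      .ofScalar {r} 1 (fun _ => 0) (one_ne_zero : (1 : 𝕜) ≠ 0) (by simp)
    let s : Fin S.q := (0 : Fin 1)
    let l : S.dense := ⟨r, Finset.mem_singleton_self r⟩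
    refine ⟨.snoc T S, ⟨hT, fun _ => rfl⟩, S.child s.castSucc l, ?_⟩
    have h := S.le_sum_norm_row_child_castSucc (σ := 1) (fun _ => rfl) (s := s) (fun _ => rfl)
      (T.row 1) l
    rw [norm_one] at h
    push_cast
    exact (add_le_add_left hr 1).trans h

theorem exists_cond_top_row_eq {m : ℕ} (hm : 1 ≤ m) :
    ∃ (n N : ℕ) (A : Matrix (Fin n) (Fin n) 𝕜) (T : Chain 𝕜 n N),
      0 < n ∧ IsUnit A.det ∧ T.AtMost m ∧ T.HasGlue ((pNorm ∞ A : ℝ) : 𝕜) ∧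
      cond ∞ (T.row A) = (m : ℝ) ^ 2 * cond ∞ A := by
  obtain ⟨q, rfl⟩ : ∃ q, m = q + 1 := ⟨m - 1, by omega⟩
  obtain ⟨T, hT, r, hr⟩ := Chain.exists_star (𝕜 := 𝕜) q
  have hA : IsUnit (1 : Matrix (Fin 1) (Fin 1) 𝕜).det := by simp
  rw [← RCLike.ofReal_one, ← pNorm_top_one (𝕜 := 𝕜)] at hT
  have hm := T.atMost_of_le le_rfl
  refine ⟨1, q + 1, 1, T, zero_lt_one, hA, hm, hT, (T.cond_top_row_le hA hm hT).antisymm ?_⟩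
  have h := cond_top_row_ge hT hr
  rw [cond_top_one]
  push_cast at h ⊢
  linarith

theorem exists_isDisjoint_cond_top_row_eq {m : ℕ} (hm : 3 ≤ m) :
    ∃ (n N : ℕ) (A : Matrix (Fin n) (Fin n) 𝕜) (T : Chain 𝕜 n N),
      0 < n ∧ IsUnit A.det ∧ T.AtMost m ∧ T.IsDisjoint ∧ T.HasGlue ((pNorm ∞ A : ℝ) : 𝕜) ∧
      cond ∞ (T.row A) = 3 * (m : ℝ) * cond ∞ A := by
  obtain ⟨q, rfl⟩ : ∃ q, m = q + 2 + 1 := ⟨m - 3, by omega⟩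
  have hσ : ((pNorm ∞ (1 : Matrix (Fin 1) (Fin 1) 𝕜) : ℝ) : 𝕜) ≠ 0 := by
    rw [pNorm_top_one]
    simp
  -- Row `1` of the path is an inner one.
  let S : Simple 𝕜 1 (q + 2 + 1) := .path (q + 2) 1 hσ
  let T : Chain 𝕜 1 (q + 2 + 1) := .snoc .nil S
  have hA : IsUnit (1 : Matrix (Fin 1) (Fin 1) 𝕜).det := by simp
  have hT : T.HasGlue ((pNorm ∞ (1 : Matrix (Fin 1) (Fin 1) 𝕜) : ℝ) : 𝕜) :=
    ⟨trivial, fun _ => rfl⟩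
  have hd : T.IsDisjoint := ⟨trivial, fun _ _ h => h⟩
  have hm := T.atMost_of_le le_rfl
  refine ⟨1, q + 2 + 1, 1, T, zero_lt_one, hA, hm, hd, hT,
    (hd.cond_top_row_le hA hm hT).antisymm ?_⟩
  let l : S.dense := ⟨0, Finset.mem_univ _⟩
  let s : Fin S.q := (0 : Fin (q + 2))
  let s' : Fin S.q := (1 : Fin (q + 2))
  have hr := S.le_sum_norm_row_child_inner (fun _ => rfl) (s := s) (s' := s') rfl (fun _ => rfl) 1 l
  rw [norm_coe_pNorm, pNorm_top_one, show (l : Fin 1) = 0 from rfl] at hr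
  have h := cond_top_row_ge hT hr
  rw [cond_top_one]
  push_cast at h ⊢
  simp at h
  linarith

end Sharpness

/-! ### Column stretching -/

section Columns

variable {𝕜 : Type*} [RCLike 𝕜] {n N : ℕ}

namespace Chain

theorem cond_one_col (A : Matrix (Fin n) (Fin n) 𝕜) (T : Chain 𝕜 n N) :
    cond 1 (T.col A) = cond ∞ (T.flip.row A.transpose) := by
  rw [row_flip_transpose, cond_top_transpose]

theorem cond_top_col (A : Matrix (Fin n) (Fin n) 𝕜) (T : Chain 𝕜 n N) :
    cond ∞ (T.col A) = cond 1 (T.flip.row A.transpose) := by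
  rw [row_flip_transpose, cond_one_transpose]

theorem isUnit_det_col_iff (A : Matrix (Fin n) (Fin n) 𝕜) (T : Chain 𝕜 n N) :
    IsUnit (T.col A).det ↔ IsUnit (T.flip.row A.transpose).det := by
  rw [row_flip_transpose, Matrix.det_transpose]

theorem cond_one_flip_col_transpose (A : Matrix (Fin n) (Fin n) 𝕜) (T : Chain 𝕜 n N) :
    cond 1 (T.flip.col A.transpose) = cond ∞ (T.row A) := by
  rw [col_flip_transpose, cond_one_transpose]

theorem cond_top_flip_col_transpose (A : Matrix (Fin n) (Fin n) 𝕜) (T : Chain 𝕜 n N) :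
    cond ∞ (T.flip.col A.transpose) = cond 1 (T.row A) := by
  rw [col_flip_transpose, cond_top_transpose]

end Chain

end Columns

end Stretching

end

theorem theorem5 {𝕜 : Type*} [RCLike 𝕜] :
    -- the bounds
    (∀ (n N m : ℕ) (A : Matrix (Fin n) (Fin n) 𝕜) (T : Stretching.Chain 𝕜 n N),
      IsUnit A.det → T.AtMost m →
      -- row stretching, `p = 1`
      (T.HasGlue ((Stretching.pNorm 1 A / 2 : ℝ) : 𝕜) →
        IsUnit (T.row A).det ∧
        Stretching.cond 1 (T.row A) ≤ (2 * (m : ℝ) - 1) * Stretching.cond 1 A) ∧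
      -- row stretching, `p = ∞`
      (T.HasGlue ((Stretching.pNorm ∞ A : ℝ) : 𝕜) →
        IsUnit (T.row A).det ∧
        Stretching.cond ∞ (T.row A) ≤ (m : ℝ) ^ 2 * Stretching.cond ∞ A ∧
        (T.IsDisjoint →
          Stretching.cond ∞ (T.row A) ≤ 3 * (m : ℝ) * Stretching.cond ∞ A)) ∧
      -- column stretching, `p = 1`
      (T.HasGlue ((Stretching.pNorm 1 A : ℝ) : 𝕜) →
        IsUnit (T.col A).det ∧
        Stretching.cond 1 (T.col A) ≤ (m : ℝ) ^ 2 * Stretching.cond 1 A ∧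
        (T.IsDisjoint →
          Stretching.cond 1 (T.col A) ≤ 3 * (m : ℝ) * Stretching.cond 1 A)) ∧
      -- column stretching, `p = ∞`
      (T.HasGlue ((Stretching.pNorm ∞ A / 2 : ℝ) : 𝕜) →
        IsUnit (T.col A).det ∧
        Stretching.cond ∞ (T.col A) ≤ (2 * (m : ℝ) - 1) * Stretching.cond ∞ A)) ∧
    -- the bounds `2m - 1` and `m²` are attained for every `m ≥ 1`
    (∀ m : ℕ, 1 ≤ m →
      (∃ (n N : ℕ) (A : Matrix (Fin n) (Fin n) 𝕜) (T : Stretching.Chain 𝕜 n N),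
        0 < n ∧ IsUnit A.det ∧ T.AtMost m ∧
        T.HasGlue ((Stretching.pNorm 1 A / 2 : ℝ) : 𝕜) ∧
        Stretching.cond 1 (T.row A) = (2 * (m : ℝ) - 1) * Stretching.cond 1 A) ∧
      (∃ (n N : ℕ) (A : Matrix (Fin n) (Fin n) 𝕜) (T : Stretching.Chain 𝕜 n N),
        0 < n ∧ IsUnit A.det ∧ T.AtMost m ∧
        T.HasGlue ((Stretching.pNorm ∞ A : ℝ) : 𝕜) ∧
        Stretching.cond ∞ (T.row A) = (m : ℝ) ^ 2 * Stretching.cond ∞ A) ∧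
      (∃ (n N : ℕ) (A : Matrix (Fin n) (Fin n) 𝕜) (T : Stretching.Chain 𝕜 n N),
        0 < n ∧ IsUnit A.det ∧ T.AtMost m ∧
        T.HasGlue ((Stretching.pNorm 1 A : ℝ) : 𝕜) ∧
        Stretching.cond 1 (T.col A) = (m : ℝ) ^ 2 * Stretching.cond 1 A) ∧
      (∃ (n N : ℕ) (A : Matrix (Fin n) (Fin n) 𝕜) (T : Stretching.Chain 𝕜 n N),
        0 < n ∧ IsUnit A.det ∧ T.AtMost m ∧
        T.HasGlue ((Stretching.pNorm ∞ A / 2 : ℝ) : 𝕜) ∧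
        Stretching.cond ∞ (T.col A) = (2 * (m : ℝ) - 1) * Stretching.cond ∞ A)) ∧
    -- the bound `3m` for disjoint sequences is attained for every `m ≥ 3`
    (∀ m : ℕ, 3 ≤ m →
      (∃ (n N : ℕ) (A : Matrix (Fin n) (Fin n) 𝕜) (T : Stretching.Chain 𝕜 n N),
        0 < n ∧ IsUnit A.det ∧ T.AtMost m ∧ T.IsDisjoint ∧
        T.HasGlue ((Stretching.pNorm ∞ A : ℝ) : 𝕜) ∧
        Stretching.cond ∞ (T.row A) = 3 * (m : ℝ) * Stretching.cond ∞ A) ∧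
      (∃ (n N : ℕ) (A : Matrix (Fin n) (Fin n) 𝕜) (T : Stretching.Chain 𝕜 n N),
        0 < n ∧ IsUnit A.det ∧ T.AtMost m ∧ T.IsDisjoint ∧
        T.HasGlue ((Stretching.pNorm 1 A : ℝ) : 𝕜) ∧
        Stretching.cond 1 (T.col A) = 3 * (m : ℝ) * Stretching.cond 1 A)) := by

  open Stretching in
  refine ⟨fun n N m A T hA hm => ⟨fun hT => ?_, fun hT => ?_, fun hT => ?_, fun hT => ?_⟩,
    fun m hm => ⟨exists_cond_one_row_eq hm, exists_cond_top_row_eq hm, ?_, ?_⟩,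
    fun m hm => ⟨exists_isDisjoint_cond_top_row_eq hm, ?_⟩⟩
  · exact ⟨T.isUnit_det_row_one hA hT, T.cond_one_row_le hA hm hT⟩
  · exact ⟨T.isUnit_det_row_top hA hT, T.cond_top_row_le hA hm hT,
      fun hd => hd.cond_top_row_le hA hm hT⟩
  · have hA' : IsUnit A.transpose.det := by rwa [Matrix.det_transpose]
    have hT' := hT.flip
    rw [← pNorm_top_transpose] at hT'
    rw [T.isUnit_det_col_iff, T.cond_one_col, ← cond_top_transpose]
    exact ⟨T.flip.isUnit_det_row_top hA' hT', T.flip.cond_top_row_le hA' hm.flip hT',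
      fun hd => hd.flip.cond_top_row_le hA' hm.flip hT'⟩
  · have hA' : IsUnit A.transpose.det := by rwa [Matrix.det_transpose]
    have hT' := hT.flip
    rw [← pNorm_one_transpose] at hT'
    rw [T.isUnit_det_col_iff, T.cond_top_col, ← cond_one_transpose]
    exact ⟨T.flip.isUnit_det_row_one hA' hT', T.flip.cond_one_row_le hA' hm.flip hT'⟩
  · obtain ⟨n, N, A, T, hn, hA, hm', hT, hc⟩ := exists_cond_top_row_eq (𝕜 := 𝕜) hm
    refine ⟨n, N, A.transpose, T.flip, hn, by rwa [Matrix.det_transpose], hm'.flip, ?_, ?_⟩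
    · rw [pNorm_one_transpose]
      exact hT.flip
    · rw [T.cond_one_flip_col_transpose, cond_one_transpose, hc]
  · obtain ⟨n, N, A, T, hn, hA, hm', hT, hc⟩ := exists_cond_one_row_eq (𝕜 := 𝕜) hm
    refine ⟨n, N, A.transpose, T.flip, hn, by rwa [Matrix.det_transpose], hm'.flip, ?_, ?_⟩
    · rw [pNorm_top_transpose]
      exact hT.flip
    · rw [T.cond_top_flip_col_transpose, cond_top_transpose, hc]
  · obtain ⟨n, N, A, T, hn, hA, hm', hd, hT, hc⟩ :=
      exists_isDisjoint_cond_top_row_eq (𝕜 := 𝕜) hm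
    refine ⟨n, N, A.transpose, T.flip, hn, by rwa [Matrix.det_transpose], hm'.flip, hd.flip, ?_, ?_⟩
    · rw [pNorm_one_transpose]
      exact hT.flip
    · rw [T.cond_one_flip_col_transpose, cond_one_transpose, hc]
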